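/- Let $\mathbb D=\{z\in\mathbb C:|z|<1\}$. A function is univalent if it is analytic and injective in $\mathbb D$. For $f,g$ analytic in $\mathbb D$, $f\prec g$ means that $f=g\circ w$ in $\mathbb D$ for some analytic $w:\mathbb D\to\mathbb D$ with $w(0)=0$. Let $\alpha,\mu\in\mathbb R$ with $0<\mu\le 1$ and $\alpha+\mu\ge 0$, and let $\beta,\gamma,\delta\in\mathbb C$ with $\beta\ne 0$. Let $\mathcal R=\mathcal R(\alpha,\beta,\gamma,\delta,\mu)$ be the class of analytic functions $p$ in $\mathbb D$ with $p(0)=1$, $p(z)\neq 0$ and $\beta p(z)+\gamma\ne 0$ for all $z\in\mathbb D$, such that $$P_p(z):=(p(z))^{\alpha}\left(p(z)+\delta+\frac{zp'(z)}{\beta p(z)+\gamma}\right)^{\mu},$$ formed with principal powers, is analytic in $\mathbb D$. For $p\in\mathcal R$ put $$F_p(z):=(p(z))^{\frac{\alpha}{\mu}+1}+\delta(p(z))^{\frac{\alpha}{\mu}}+(p(z))^{\frac{\alpha}{\mu}}\frac{zp'(z)}{\beta p(z)+\gamma},$$ where $p^{c}=\exp(c\log p)$ with the analytic branch of $\log p$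 in $\mathbb D$ that vanishes at $0$. (If the same expression with principal powers is analytic in $\mathbb D$, it equals $F_p$.) Let $\mathcal Q$ be the class of functions $f$ that are analytic and injective on $\overline{\mathbb D}\setminus E(f)$, where $E(f)=\{\zeta\in\partial\mathbb D:\lim_{z\to\zeta}f(z)=\infty\}$ (limit from within $\mathbb D$), with $f'(\zeta)\ne0$ for $\zeta\in\partial\mathbb D\setminus E(f)$. Let $q_1,q_2\in\mathcal R$ be univalent, and put $R_i(z):=zq_i'(z)/(\beta q_i(z)+\gamma)$ and $h_i:=P_{q_i}$. Assume for $i=1,2$ that $$\operatorname{Re}\left((\beta q_i(z)+\gamma)\left(1+\frac{\alpha}{\mu}+\frac{\alpha\delta}{\mu q_i(z)}\right)\right)>0\quad(z\in\mathbb D),$$ $$\operatorname{Re}\left(\frac{\alpha}{\mu}\frac{zq_i'(z)}{q_i(z)}+\frac{zR_i'(z)}{R_i(z)}\right)>0\quad(z\in\mathbb D\setminus\{0\}).$$ Then: 1. If $p\in\mathcal R\cap\mathcal Q$, $F_p$ is univalent and $h_1\prec P_p\prec h_2$, then $q_1\prec p\prec q_2$. 2. $q_1$ is the best subordinant of the superordination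 $h_1\prec P_p$: it is univalent; $q_1\prec p$ for every univalent $p\in\mathcal R$ with $F_p$ univalent and $h_1\prec P_p$; and every analytic $q$ in $\mathbb D$ with $q\prec p$ for all such $p$ satisfies $q\prec q_1$. 3. $q_2$ is the best dominant of the subordination $P_p\prec h_2$: it is univalent; $p\prec q_2$ for every $p\in\mathcal R$ with $P_p\prec h_2$; and every univalent $q$ with $p\prec q$ for all such $p$ satisfies $q_2\prec q$. -/

import Mathlib

open Set Filter Topology

noncomputable section

/-- The open unit disk of the complex plane. -/
def unitDisk : Set ℂ := Metric.ball 0 1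

/-- Univalent in the unit disk: analytic and injective there. -/
def IsUnivalent (f : ℂ → ℂ) : Prop :=
  AnalyticOnNhd ℂ f unitDisk ∧ InjOn f unitDisk

/-- Subordination of `f` to `g`, both analytic in the unit disk, through a Schwarz function `w`. -/
def Subordinate (f g : ℂ → ℂ) : Prop :=
  AnalyticOnNhd ℂ f unitDisk ∧ AnalyticOnNhd ℂ g unitDisk ∧
    ∃ w : ℂ → ℂ, AnalyticOnNhd ℂ w unitDisk ∧ w 0 = 0 ∧ (∀ z ∈ unitDisk, ‖w z‖ < 1) ∧
      ∀ z ∈ unitDisk, f z = g (w z)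

/-- The set of boundary points at which `f` (a function on the disk) tends to infinity. -/
def infinitySet (f : ℂ → ℂ) : Set ℂ :=
  {ζ | ‖ζ‖ = 1 ∧ Tendsto f (𝓝[unitDisk] ζ) (Bornology.cobounded ℂ)}

/-- The class of functions on the unit disk that are (after extension) analytic and injective on
the closed disk without the boundary points where they tend to infinity, with nonvanishing
derivative at the remaining boundary points. The extension `g` is needed because only the values
of `f` in the open disk carry information. -/
def ClassQ (f : ℂ → ℂ) : Prop :=
  ∃ g : ℂ → ℂ, EqOn g f unitDisk ∧
    AnalyticOnNhd ℂ g (Metric.closedBall 0 1 \ infinitySet f) ∧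
    InjOn g (Metric.closedBall 0 1 \ infinitySet f) ∧
    ∀ ζ : ℂ, ‖ζ‖ = 1 → ζ ∉ infinitySet f → deriv g ζ ≠ 0

/-- The function `z p'(z) / (β p(z) + γ)`. -/
def bbTerm (β γ : ℂ) (p : ℂ → ℂ) (z : ℂ) : ℂ :=
  z * deriv p z / (β * p z + γ)

/-- The differential expression `p^α (p + δ + z p' / (β p + γ))^μ`, with principal powers. -/
def diffExpr (α : ℝ) (β γ δ : ℂ) (μ : ℝ) (p : ℂ → ℂ) (z : ℂ) : ℂ :=
  (p z) ^ (α : ℂ) * (p z + δ + bbTerm β γ p z) ^ (μ : ℂ)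

/-- The class `R(α, β, γ, δ, μ)`. That the differential expression is well defined in the disk
means that the denominator has no zero there and that the principal powers give an analytic
function. -/
structure ClassR (α : ℝ) (β γ δ : ℂ) (μ : ℝ) (p : ℂ → ℂ) : Prop where
  analytic : AnalyticOnNhd ℂ p unitDisk
  map_zero : p 0 = 1
  ne_zero : ∀ z ∈ unitDisk, p z ≠ 0
  denom_ne_zero : ∀ z ∈ unitDisk, β * p z + γ ≠ 0
  expr_analytic : AnalyticOnNhd ℂ (diffExpr α β γ δ μ p) unitDisk

/-- The function `p^(α/μ+1) + δ p^(α/μ) + p^(α/μ) z p' / (β p + γ)` is univalent. Here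
`p^c = exp (c ℓ)`, with `ℓ` the analytic logarithm of `p` in the disk that vanishes at `0`.
If the expression formed with principal powers is analytic in the disk, it is this function:
the two agree near `0`, as `p 0 = 1`. -/
def PowerExprUnivalent (α : ℝ) (β γ δ : ℂ) (μ : ℝ) (p : ℂ → ℂ) : Prop :=
  ∃ ℓ : ℂ → ℂ, AnalyticOnNhd ℂ ℓ unitDisk ∧ ℓ 0 = 0 ∧
    (∀ z ∈ unitDisk, Complex.exp (ℓ z) = p z) ∧
    IsUnivalent fun z =>
      Complex.exp (((α / μ + 1 : ℝ) : ℂ) * ℓ z) + δ * Complex.exp (((α / μ : ℝ) : ℂ) * ℓ z)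
        + Complex.exp (((α / μ : ℝ) : ℂ) * ℓ z) * bbTerm β γ p z

/-- Solutions `p` of the differential superordination `h ≺ p^α (p + δ + z p' / (β p + γ))^μ`. -/
def superSolutions (α : ℝ) (β γ δ : ℂ) (μ : ℝ) (h : ℂ → ℂ) : Set (ℂ → ℂ) :=
  {p | ClassR α β γ δ μ p ∧ IsUnivalent p ∧ PowerExprUnivalent α β γ δ μ p ∧
    Subordinate h (diffExpr α β γ δ μ p)}

/-- Solutions `p` of the differential subordination `p^α (p + δ + z p' / (β p + γ))^μ ≺ h`. -/
def subSolutions (α : ℝ) (β γ δ : ℂ) (μ : ℝ) (h : ℂ → ℂ) : Set (ℂ → ℂ) :=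
  {p | ClassR α β γ δ μ p ∧ Subordinate (diffExpr α β γ δ μ p) h}

/-- `q` is a subordinant of the solution set `S`. -/
def IsSubordinant (S : Set (ℂ → ℂ)) (q : ℂ → ℂ) : Prop :=
  AnalyticOnNhd ℂ q unitDisk ∧ ∀ p ∈ S, Subordinate q p

/-- `q` is the best subordinant: a univalent subordinant to which all subordinants are
subordinate. -/
def IsBestSubordinant (S : Set (ℂ → ℂ)) (q : ℂ → ℂ) : Prop :=
  IsUnivalent q ∧ IsSubordinant S q ∧ ∀ q', IsSubordinant S q' → Subordinate q' q

/-- `q` is a dominant of the solution set `S`. -/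
def IsDominant (S : Set (ℂ → ℂ)) (q : ℂ → ℂ) : Prop :=
  IsUnivalent q ∧ ∀ p ∈ S, Subordinate p q

/-- `q` is the best dominant: a dominant that is subordinate to all dominants. -/
def IsBestDominant (S : Set (ℂ → ℂ)) (q : ℂ → ℂ) : Prop :=
  IsDominant S q ∧ ∀ q', IsDominant S q' → Subordinate q q'

/-- The two positivity conditions on `q`. In the second one `R = z q' / (β q + γ)` vanishes at
`0`, where `z R' / R` has a removable singularity with value `1`; the condition holds there
automatically, so it is stated away from `0`. -/
structure PositivityConditions (α : ℝ) (β γ δ : ℂ) (μ : ℝ) (q : ℂ → ℂ) : Prop where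
  first : ∀ z ∈ unitDisk,
    0 < ((β * q z + γ) * (1 + (α : ℂ) / μ + (α : ℂ) * δ / (μ * q z))).re
  second : ∀ z ∈ unitDisk, z ≠ 0 →
    0 < ((α : ℂ) / μ * (z * deriv q z / q z)
      + z * deriv (bbTerm β γ q) z / bbTerm β γ q z).re

end

/-! Write a = α/μ, u = log p, v = log q. In logarithmic coordinates F_p is an expression `logSymbol`
in u and z u' that is affine in its second argument. Along q it becomes T + s z g' when z v' is
replaced by s z v', where g' = e^{(a+1)v} v' / (βq + γ). The second positivity condition says that g
is convex. The first says Re (T'/g') > 0, so T, and with it every T + s z g' with s ≥ 0, is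
close-to-convex relative to g.

If a required inclusion of images fails, the logarithms have a first contact at an interior circle
(`exists_boundary_contact`), and Jack's lemma makes their z-derivatives there proportional with
factor m ≥ 1. For the subordination, F_p at the contact lies (m - 1) outward normals beyond F_q at
the contact point of q. `eq_of_apply_eq_add_normal` shows that F_q takes no such value at another
point of the closed disc bounded by that circle, whereas the Schwarz function produces one. For the
superordination the factor is 1/m ≤ 1, and `exists_apply_eq_of_chain` shows that F_q does take the
contact value strictly inside the circle. Univalence of F_p then contradicts the Schwarz lemma.

Principal powers are disposed of near 0: there F is a function of the value of P that depends only
on μ and δ, so P_p = P_q ∘ w gives F_p = F_q ∘ w, first locally and then by the identity theorem.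
The bounds are best because q₁ and q₂ are themselves solutions. -/

/-! ### Injective analytic functions, primitives and logarithms -/

/-- At a zero of f' of order n - 1, f is an n-th power in a local coordinate φ, and φ-values that
differ by a primitive n-th root of unity have the same image. -/
theorem deriv_ne_zero_of_injOn {f : ℂ → ℂ} {U : Set ℂ} {z₀ : ℂ} (hf : AnalyticAt ℂ f z₀)
    (hU : U ∈ 𝓝 z₀) (hinj : InjOn f U) : deriv f z₀ ≠ 0 := by
  intro hd
  have hf' : AnalyticAt ℂ (fun z => f z - f z₀) z₀ := hf.sub analyticAt_const
  have hnc : ¬ ∀ᶠ z in 𝓝 z₀, f z - f z₀ = 0 := by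
    intro h
    have h1 : ∀ᶠ z in 𝓝[≠] z₀, f z - f z₀ = 0 ∧ z ∈ U := (h.and hU).filter_mono nhdsWithin_le_nhds
    obtain ⟨z, ⟨hz, hzU⟩, hne⟩ := (h1.and self_mem_nhdsWithin).exists
    exact hne (hinj hzU (mem_of_mem_nhds hU) (sub_eq_zero.1 hz))
  obtain ⟨n, g, hg, hg0, hfg⟩ := hf'.exists_eventuallyEq_pow_smul_nonzero_iff.2 hnc
  have hn0 : n ≠ 0 := by
    rintro rfl
    have := hfg.self_of_nhds
    simp at this
    exact hg0 this.symm
  -- Dividing by `g z₀` moves the value at `z₀` to 1, where the principal n-th root is analytic.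
  set r : ℂ → ℂ := fun z => (g z / g z₀) ^ (1 / (n : ℂ)) with hr
  have hgslit : g z₀ / g z₀ ∈ Complex.slitPlane := by rw [div_self hg0]; exact Complex.one_mem_slitPlane
  have hra : AnalyticAt ℂ r z₀ :=
    (hg.div analyticAt_const hg0).cpow analyticAt_const hgslit
  have hrn : ∀ z, r z ^ n = g z / g z₀ := by
    intro z
    change ((g z / g z₀) ^ (1 / (n : ℂ))) ^ n = _
    rw [one_div, Complex.cpow_nat_inv_pow _ hn0]
  have hr0 : r z₀ = 1 := by simp [hr, div_self hg0]
  set φ : ℂ → ℂ := fun z => (z - z₀) * r z with hφ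
  have hφd : HasStrictDerivAt φ 1 z₀ := by
    have h1 : HasStrictDerivAt (fun z : ℂ => z - z₀) 1 z₀ := (hasStrictDerivAt_id z₀).sub_const z₀
    refine (h1.mul hra.hasStrictDerivAt).congr_deriv ?_
    simp [hr0]
  have hfφ : ∀ᶠ z in 𝓝 z₀, f z = f z₀ + g z₀ * φ z ^ n := by
    filter_upwards [hfg] with z hz
    simp only [hφ, mul_pow, hrn]
    rw [smul_eq_mul] at hz
    field_simp
    linear_combination hz
  have hn1 : n ≠ 1 := by
    rintro rfl
    have h1 : HasDerivAt (fun z => f z₀ + g z₀ * φ z ^ 1) (g z₀) z₀ := by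
      simpa using (hφd.hasDerivAt.const_mul (g z₀)).const_add (f z₀)
    have h2 := (h1.congr_of_eventuallyEq hfφ).deriv
    exact hg0 (h2.symm.trans hd)
  have hmem : φ '' {z | f z = f z₀ + g z₀ * φ z ^ n ∧ z ∈ U} ∈ 𝓝 (0 : ℂ) := by
    have h := hφd.map_nhds_eq one_ne_zero
    have h0 : φ z₀ = 0 := by simp [hφ]
    rw [h0] at h
    rw [← h]
    exact image_mem_map (hfφ.and hU)
  set ω : ℂ := Complex.exp (2 * Real.pi * Complex.I / n) with hω
  have hprim : IsPrimitiveRoot ω n := Complex.isPrimitiveRoot_exp n hn0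
  have hmem2 : ∀ᶠ η in 𝓝 (0 : ℂ), ω * η ∈ φ '' {z | f z = f z₀ + g z₀ * φ z ^ n ∧ z ∈ U} := by
    have : Tendsto (fun η : ℂ => ω * η) (𝓝 0) (𝓝 0) := by
      simpa using (continuous_const_mul ω).tendsto (0 : ℂ)
    exact this hmem
  have hev : ∀ᶠ η in 𝓝[≠] (0 : ℂ), η ∈ φ '' {z | f z = f z₀ + g z₀ * φ z ^ n ∧ z ∈ U} ∧
      ω * η ∈ φ '' {z | f z = f z₀ + g z₀ * φ z ^ n ∧ z ∈ U} :=
    (Filter.Eventually.and hmem hmem2).filter_mono nhdsWithin_le_nhds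
  obtain ⟨η, ⟨⟨a, ⟨ha, haU⟩, haη⟩, ⟨b, ⟨hb, hbU⟩, hbη⟩⟩, hη⟩ := (hev.and self_mem_nhdsWithin).exists
  have hab : a = b := hinj haU hbU (by rw [ha, hb, haη, hbη, mul_pow, hprim.pow_eq_one, one_mul])
  rw [← hab, haη] at hbη
  have : ω = 1 := by
    have := mul_right_cancel₀ hη (hbη.symm.trans (one_mul η).symm)
    exact this
  exact hn1 (by rw [hprim.eq_orderOf, this, orderOf_one])

theorem AnalyticOnNhd.exists_inverse_of_injOn {f : ℂ → ℂ} {U : Set ℂ} (hU : IsOpen U)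
    (hf : AnalyticOnNhd ℂ f U) (hinj : InjOn f U) :
    IsOpen (f '' U) ∧ ∃ k : ℂ → ℂ, AnalyticOnNhd ℂ k (f '' U) ∧ (∀ z ∈ U, k (f z) = z) ∧
      ∀ z ∈ U, HasDerivAt k (deriv f z)⁻¹ (f z) := by
  have hd : ∀ z ∈ U, deriv f z ≠ 0 := fun z hz =>
    deriv_ne_zero_of_injOn (hf z hz) (hU.mem_nhds hz) hinj
  have ho : IsOpen (f '' U) := by
    rw [isOpen_iff_mem_nhds]
    rintro _ ⟨z, hz, rfl⟩
    rw [← (hf z hz).hasStrictDerivAt.map_nhds_eq (hd z hz)]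
    exact image_mem_map (hU.mem_nhds hz)
  have hk : ∀ z ∈ U, Function.invFunOn f U (f z) = z := fun z hz => hinj.leftInvOn_invFunOn hz
  have hkd : ∀ z ∈ U, HasDerivAt (Function.invFunOn f U) (deriv f z)⁻¹ (f z) := fun z hz =>
    ((hf z hz).hasStrictDerivAt.to_local_left_inverse (hd z hz)
      (by filter_upwards [hU.mem_nhds hz] with x hx using hk x hx)).hasDerivAt
  refine ⟨ho, Function.invFunOn f U, ?_, hk, hkd⟩
  apply DifferentiableOn.analyticOnNhd _ ho
  rintro _ ⟨z, hz, rfl⟩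
  exact (hkd z hz).differentiableAt.differentiableWithinAt

theorem AnalyticOnNhd.exists_primitive {f : ℂ → ℂ} (hf : AnalyticOnNhd ℂ f unitDisk) (y : ℂ) :
    ∃ g : ℂ → ℂ, AnalyticOnNhd ℂ g unitDisk ∧ g 0 = y ∧ ∀ z ∈ unitDisk, HasDerivAt g (f z) z := by
  obtain ⟨g, hg0, hg⟩ := (DifferentiableOn.isExactOn_ball hf.differentiableOn).with_val_at 0 y
  refine ⟨g, ?_, hg0, hg⟩
  exact DifferentiableOn.analyticOnNhd
    (fun z hz => (hg z hz).differentiableAt.differentiableWithinAt) Metric.isOpen_ball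

theorem zero_mem_unitDisk : (0 : ℂ) ∈ unitDisk := by simp [unitDisk]

theorem mem_unitDisk {z : ℂ} : z ∈ unitDisk ↔ ‖z‖ < 1 := by simp [unitDisk]

theorem isOpen_unitDisk : IsOpen unitDisk := Metric.isOpen_ball

theorem isPreconnected_unitDisk : IsPreconnected unitDisk :=
  (convex_ball (0 : ℂ) 1).isPreconnected

theorem AnalyticOnNhd.exists_log {f : ℂ → ℂ} (hf : AnalyticOnNhd ℂ f unitDisk)
    (h0 : ∀ z ∈ unitDisk, f z ≠ 0) :
    ∃ ℓ : ℂ → ℂ, AnalyticOnNhd ℂ ℓ unitDisk ∧ ℓ 0 = Complex.log (f 0) ∧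
      ∀ z ∈ unitDisk, Complex.exp (ℓ z) = f z := by
  obtain ⟨ℓ, hℓ, hℓ0, hℓd⟩ := (hf.deriv.div hf h0).exists_primitive (Complex.log (f 0))
  refine ⟨ℓ, hℓ, hℓ0, ?_⟩
  have hd : ∀ z ∈ unitDisk, HasDerivAt (fun z => f z * Complex.exp (-ℓ z)) 0 z := by
    intro z hz
    have h1 : HasDerivAt (fun z => f z * Complex.exp (-ℓ z)) _ z :=
      (hf z hz).differentiableAt.hasDerivAt.mul (hℓd z hz).neg.cexp
    refine h1.congr_deriv ?_
    have := h0 z hz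
    field_simp
    simp
  intro z hz
  have hc := (convex_ball (0 : ℂ) 1).is_const_of_fderivWithin_eq_zero (𝕜 := ℂ)
    (f := fun z => f z * Complex.exp (-ℓ z))
    (fun z hz => (hd z hz).differentiableAt.differentiableWithinAt)
    (fun z hz => by
      rw [fderivWithin_of_isOpen Metric.isOpen_ball hz]
      have := (hd z hz).hasFDerivAt.fderiv
      simpa using this) hz zero_mem_unitDisk
  have h00 := h0 0 zero_mem_unitDisk
  simp only [hℓ0, Complex.exp_neg, Complex.exp_log h00] at hc
  rw [mul_inv_cancel₀ h00] at hc
  have := Complex.exp_ne_zero (ℓ z)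
  field_simp at hc
  exact hc.symm

/-! ### Convex functions: supporting lines and convex image -/

/-- The outward normal z g'(z) of the image curve turns strictly monotonically, by 2π in all. The
height of the curve in the direction of the normal at z₀ therefore falls until the normal has turned
by π and then rises back, so z₀ is its only maximum. -/
theorem re_mul_conj_lt_on_circle {g : ℂ → ℂ} (hg : AnalyticOnNhd ℂ g unitDisk)
    (hg' : ∀ z ∈ unitDisk, deriv g z ≠ 0)
    (hc : ∀ z ∈ unitDisk, 0 < (1 + z * deriv (deriv g) z / deriv g z).re)
    {z₀ z₁ : ℂ} (h0 : z₀ ∈ unitDisk) (h01 : ‖z₁‖ = ‖z₀‖) (hne : z₁ ≠ z₀) :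
    (g z₁ * starRingEnd ℂ (z₀ * deriv g z₀)).re < (g z₀ * starRingEnd ℂ (z₀ * deriv g z₀)).re := by
  obtain ⟨k, hk, -, hkexp⟩ := hg.deriv.exists_log hg'
  have hkd : ∀ z ∈ unitDisk, deriv k z = deriv (deriv g) z / deriv g z := by
    intro z hz
    have h1 : HasDerivAt (fun z => Complex.exp (k z)) (Complex.exp (k z) * deriv k z) z :=
      (hk z hz).differentiableAt.hasDerivAt.cexp
    have h2 : (fun z => Complex.exp (k z)) =ᶠ[𝓝 z] deriv g := by
      filter_upwards [isOpen_unitDisk.mem_nhds hz] with x hx using hkexp x hx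
    have h3 := h2.deriv_eq
    rw [h1.deriv, hkexp z hz] at h3
    rw [← h3, mul_div_cancel_left₀ _ (hg' z hz)]
  have hz0 : z₀ ≠ 0 := by
    rintro rfl
    rw [norm_zero, norm_eq_zero] at h01
    exact hne h01
  set e : ℝ → ℂ := fun θ => z₀ * Complex.exp (θ * Complex.I) with he
  have hen : ∀ θ, ‖e θ‖ = ‖z₀‖ := fun θ => by simp [he, Complex.norm_exp_ofReal_mul_I]
  have heD : ∀ θ, e θ ∈ unitDisk := fun θ => by
    rw [mem_unitDisk, hen]; exact mem_unitDisk.1 h0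
  have hed : ∀ θ : ℝ, HasDerivAt e (e θ * Complex.I) θ := by
    intro θ
    have h1 : HasDerivAt (fun x : ℝ => (x : ℂ) * Complex.I) (1 * Complex.I) θ :=
      (Complex.ofRealCLM.hasDerivAt (x := θ)).mul_const Complex.I
    refine (h1.cexp.const_mul z₀).congr_deriv ?_
    simp only [he]; ring
  -- Up to the factor |z₀|², exp W is the normal at `e θ` times the conjugate of the normal at z₀;
  -- Im W is the angle turned.
  set W : ℝ → ℂ := fun θ => θ * Complex.I + k (e θ) + starRingEnd ℂ (k z₀) with hW
  have hWim : ∀ θ, (W θ).im = θ + (k (e θ)).im - (k z₀).im := fun θ => by simp [hW]; ring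
  have hke : ∀ θ : ℝ, HasDerivAt (fun θ => k (e θ)) (deriv k (e θ) * (e θ * Complex.I)) θ :=
    fun θ => (hk _ (heD θ)).differentiableAt.hasDerivAt.comp θ (hed θ)
  have hτd : ∀ θ : ℝ, HasDerivAt (fun θ => (W θ).im)
      (1 + e θ * deriv (deriv g) (e θ) / deriv g (e θ)).re θ := by
    intro θ
    have h1 : HasDerivAt (fun θ => (k (e θ)).im) (deriv k (e θ) * (e θ * Complex.I)).im θ :=
      Complex.imCLM.hasFDerivAt.comp_hasDerivAt θ (hke θ)
    have h2 := ((hasDerivAt_id θ).add h1).sub_const (k z₀).im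
    have h3 : HasDerivAt (fun θ => (W θ).im) (1 + (deriv k (e θ) * (e θ * Complex.I)).im) θ :=
      h2.congr_of_eventuallyEq (Eventually.of_forall fun x => by simp [hWim])
    refine h3.congr_deriv ?_
    rw [hkd _ (heD θ), ← mul_assoc, Complex.mul_I_im, Complex.add_re, Complex.one_re]
    congr 2; ring
  have hτmono : StrictMono fun θ => (W θ).im :=
    strictMono_of_deriv_pos fun θ => by rw [(hτd θ).deriv]; exact hc _ (heD θ)
  have hτcont : Continuous fun θ => (W θ).im :=
    continuous_iff_continuousAt.2 fun θ => (hτd θ).continuousAt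
  have he0 : e 0 = z₀ := by simp [he]
  have he2 : e (2 * Real.pi) = z₀ := by simp [he]
  have hτ0 : (W 0).im = 0 := by simp [hWim, he0]
  have hτ2 : (W (2 * Real.pi)).im = 2 * Real.pi := by simp [hWim, he2]
  set Λ : ℝ → ℝ := fun θ => (g (e θ) * starRingEnd ℂ (z₀ * deriv g z₀)).re with hΛ
  have hΛd : ∀ θ : ℝ, HasDerivAt Λ
      (-(Complex.normSq z₀ * (Real.exp (W θ).re * Real.sin (W θ).im))) θ := by
    intro θ
    have h1 : HasDerivAt (fun θ => g (e θ)) (deriv g (e θ) * (e θ * Complex.I)) θ :=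
      (hg _ (heD θ)).differentiableAt.hasDerivAt.comp θ (hed θ)
    have h2 : HasDerivAt Λ _ θ := Complex.reCLM.hasFDerivAt.comp_hasDerivAt θ
      (h1.mul_const (starRingEnd ℂ (z₀ * deriv g z₀)))
    refine h2.congr_deriv ?_
    have h3 : deriv g (e θ) * (e θ * Complex.I) * starRingEnd ℂ (z₀ * deriv g z₀)
        = (Complex.normSq z₀ : ℂ) * Complex.exp (W θ) * Complex.I := by
      rw [← hkexp _ (heD θ), ← hkexp _ h0, map_mul, ← Complex.exp_conj, Complex.normSq_eq_conj_mul_self]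
      simp only [hW, he, Complex.exp_add]
      ring
    rw [h3, Complex.reCLM_apply, Complex.mul_I_re]
    simp [Complex.exp_im]
  have hΛcont : Continuous Λ := continuous_iff_continuousAt.2 fun θ => (hΛd θ).continuousAt
  have hz0n : 0 < Complex.normSq z₀ := Complex.normSq_pos.2 hz0
  have hpi := Real.pi_pos
  obtain ⟨θs, hθs, hθsτ⟩ : ∃ θ ∈ Icc 0 (2 * Real.pi), (W θ).im = Real.pi :=
    intermediate_value_Icc (by positivity) hτcont.continuousOn
      (by rw [hτ0, hτ2]; constructor <;> linarith)
  have hanti : StrictAntiOn Λ (Icc 0 θs) := by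
    apply strictAntiOn_of_deriv_neg (convex_Icc _ _) hΛcont.continuousOn
    intro θ hθ
    rw [interior_Icc] at hθ
    rw [(hΛd θ).deriv, neg_lt_zero]
    have h1 : 0 < (W θ).im := hτ0 ▸ hτmono hθ.1
    have h2 : (W θ).im < Real.pi := hθsτ ▸ hτmono hθ.2
    have := Real.sin_pos_of_pos_of_lt_pi h1 h2
    positivity
  have hmono : StrictMonoOn Λ (Icc θs (2 * Real.pi)) := by
    apply strictMonoOn_of_deriv_pos (convex_Icc _ _) hΛcont.continuousOn
    intro θ hθ
    rw [interior_Icc] at hθ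
    rw [(hΛd θ).deriv]
    have h1 : Real.pi < (W θ).im := hθsτ ▸ hτmono hθ.1
    have h2 : (W θ).im < 2 * Real.pi := by
      simpa only [hτ2] using hτmono hθ.2
    have h3 : Real.sin (W θ).im < 0 := by
      have := Real.sin_neg_of_neg_of_neg_pi_lt (x := (W θ).im - 2 * Real.pi) (by linarith) (by linarith)
      rwa [Real.sin_sub_two_pi] at this
    have h4 := Real.exp_pos (W θ).re
    have : Complex.normSq z₀ * (Real.exp (W θ).re * Real.sin (W θ).im) < 0 :=
      mul_neg_of_pos_of_neg hz0n (mul_neg_of_pos_of_neg h4 h3)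
    linarith
  have hlt : ∀ θ ∈ Ioo 0 (2 * Real.pi), Λ θ < Λ 0 := by
    intro θ hθ
    rcases le_total θ θs with h | h
    · exact hanti ⟨le_rfl, hθs.1⟩ ⟨hθ.1.le, h⟩ hθ.1
    · have := hmono ⟨h, hθ.2.le⟩ ⟨hθs.2, le_rfl⟩ hθ.2
      simpa [hΛ, he0, he2] using this
  obtain ⟨θ, hθ, hθz⟩ : ∃ θ ∈ Ioo 0 (2 * Real.pi), e θ = z₁ := by
    have h1 : z₀ * Complex.exp ((z₁ / z₀).arg * Complex.I) = z₁ := by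
      have h2 := Complex.norm_mul_exp_arg_mul_I (z₁ / z₀)
      rw [norm_div, h01, div_self (norm_ne_zero_iff.2 hz0), Complex.ofReal_one, one_mul] at h2
      rw [h2]; field_simp
    rcases lt_trichotomy (z₁ / z₀).arg 0 with h | h | h
    · refine ⟨(z₁ / z₀).arg + 2 * Real.pi, ⟨?_, by linarith⟩, ?_⟩
      · have := Complex.neg_pi_lt_arg (z₁ / z₀); linarith
      · conv_rhs => rw [← h1]
        simp only [he]
        push_cast
        rw [add_mul, Complex.exp_add, Complex.exp_two_pi_mul_I, mul_one]
    · rw [h] at h1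
      exact absurd (by simpa using h1.symm) hne
    · exact ⟨_, ⟨h, by have := Complex.arg_le_pi (z₁ / z₀); linarith⟩, h1⟩
  have := hlt θ hθ
  simpa only [hΛ, he0, hθz] using this

/-- The supporting line at z₀ also bounds the image of the inner disc: the maximum principle for
exp(c g) gives the weak inequality, and openness of g makes it strict. -/
theorem re_sub_mul_conj_pos {g : ℂ → ℂ} (hg : AnalyticOnNhd ℂ g unitDisk)
    (hg' : ∀ z ∈ unitDisk, deriv g z ≠ 0)
    (hc : ∀ z ∈ unitDisk, 0 < (1 + z * deriv (deriv g) z / deriv g z).re)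
    {z₀ z₁ : ℂ} (h0 : z₀ ∈ unitDisk) (h01 : ‖z₁‖ ≤ ‖z₀‖) (hne : z₁ ≠ z₀) :
    0 < ((g z₀ - g z₁) * starRingEnd ℂ (z₀ * deriv g z₀)).re := by
  rw [sub_mul, Complex.sub_re, sub_pos]
  rcases h01.eq_or_lt with h | h
  · exact re_mul_conj_lt_on_circle hg hg' hc h0 h hne
  set c := starRingEnd ℂ (z₀ * deriv g z₀) with hcdef
  have hz0 : z₀ ≠ 0 := by
    rintro rfl
    simp at h
    exact absurd h (norm_nonneg _).not_gt
  have hc0 : c ≠ 0 := by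
    rw [hcdef, Ne, map_eq_zero]; exact mul_ne_zero hz0 (hg' _ h0)
  have hr : 0 < ‖z₀‖ := norm_pos_iff.2 hz0
  have hsub : Metric.closedBall (0 : ℂ) ‖z₀‖ ⊆ unitDisk := fun z hz => by
    rw [mem_closedBall_zero_iff] at hz
    exact mem_unitDisk.2 (hz.trans_lt (mem_unitDisk.1 h0))
  have hle : ∀ z ∈ Metric.ball (0 : ℂ) ‖z₀‖, (g z * c).re ≤ (g z₀ * c).re := by
    intro z hz
    have hd : DiffContOnCl ℂ (fun z => Complex.exp (g z * c)) (Metric.ball 0 ‖z₀‖) := by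
      apply DifferentiableOn.diffContOnCl
      rw [closure_ball _ hr.ne']
      exact ((hg.differentiableOn.mono hsub).mul_const c).cexp
    have := Complex.norm_le_of_forall_mem_frontier_norm_le Metric.isBounded_ball hd
      (C := Real.exp (g z₀ * c).re) (fun w hw => ?_) (subset_closure hz)
    · rw [Complex.norm_exp, Real.exp_le_exp] at this
      exact this
    · rw [frontier_ball _ hr.ne', mem_sphere_zero_iff_norm] at hw
      rw [Complex.norm_exp, Real.exp_le_exp]
      by_cases hwz : w = z₀
      · rw [hwz]
      · exact (re_mul_conj_lt_on_circle hg hg' hc h0 hw hwz).le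
  have hz1D : z₁ ∈ unitDisk := hsub (mem_closedBall_zero_iff.2 h01)
  have hz1 : z₁ ∈ Metric.ball (0 : ℂ) ‖z₀‖ := mem_ball_zero_iff.2 h
  have hd : HasStrictDerivAt (fun z => g z * c) (deriv g z₁ * c) z₁ :=
    (hg _ hz1D).hasStrictDerivAt.mul_const c
  have hmem : (fun z => g z * c) '' Metric.ball (0 : ℂ) ‖z₀‖ ∈ 𝓝 (g z₁ * c) := by
    rw [← hd.map_nhds_eq (mul_ne_zero (hg' _ hz1D) hc0)]
    exact image_mem_map (Metric.isOpen_ball.mem_nhds hz1)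
  have hsubset : (fun z => g z * c) '' Metric.ball (0 : ℂ) ‖z₀‖ ⊆ {w | w.re ≤ (g z₀ * c).re} := by
    rintro _ ⟨z, hz, rfl⟩
    exact hle z hz
  have := mem_interior_iff_mem_nhds.2 (mem_of_superset hmem hsubset)
  rwa [Complex.interior_setOfPred_re_le] at this

theorem injOn_of_convex {g : ℂ → ℂ} (hg : AnalyticOnNhd ℂ g unitDisk)
    (hg' : ∀ z ∈ unitDisk, deriv g z ≠ 0)
    (hc : ∀ z ∈ unitDisk, 0 < (1 + z * deriv (deriv g) z / deriv g z).re) : InjOn g unitDisk := by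
  intro a ha b hb hab
  by_contra hne
  rcases le_total ‖a‖ ‖b‖ with h | h
  · have := re_sub_mul_conj_pos hg hg' hc hb h hne
    simp [hab] at this
  · have := re_sub_mul_conj_pos hg hg' hc ha h (Ne.symm hne)
    simp [hab] at this

/-- A segment between two values taken inside radius r cannot meet the image of the circle of radius
r: at such a point both ends would lie strictly on one side of the supporting line. Connectedness
keeps the segment in the image of the open disc. -/
theorem convex_image_unitDisk {g : ℂ → ℂ} (hg : AnalyticOnNhd ℂ g unitDisk)
    (hg' : ∀ z ∈ unitDisk, deriv g z ≠ 0)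
    (hc : ∀ z ∈ unitDisk, 0 < (1 + z * deriv (deriv g) z / deriv g z).re) :
    Convex ℝ (g '' unitDisk) := by
  have hinj := injOn_of_convex hg hg' hc
  rw [convex_iff_segment_subset]
  rintro _ ⟨a, ha, rfl⟩ _ ⟨b, hb, rfl⟩
  obtain ⟨r, hr, hr1⟩ : ∃ r, max ‖a‖ ‖b‖ < r ∧ r < 1 :=
    exists_between (max_lt (mem_unitDisk.1 ha) (mem_unitDisk.1 hb))
  have har : ‖a‖ < r := (le_max_left _ _).trans_lt hr
  have hbr : ‖b‖ < r := (le_max_right _ _).trans_lt hr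
  have hsub : Metric.closedBall (0 : ℂ) r ⊆ unitDisk := fun z hz =>
    mem_unitDisk.2 ((mem_closedBall_zero_iff.1 hz).trans_lt hr1)
  have hbs : Metric.ball (0 : ℂ) r ⊆ unitDisk := Metric.ball_subset_closedBall.trans hsub
  have hu : IsOpen (g '' Metric.ball 0 r) :=
    ((hg.mono hbs).exists_inverse_of_injOn Metric.isOpen_ball (hinj.mono hbs)).1
  have hv : IsClosed (g '' Metric.closedBall 0 r) :=
    ((isCompact_closedBall 0 r).image_of_continuousOn (hg.continuousOn.mono hsub)).isClosed
  have key : segment ℝ (g a) (g b) ⊆ g '' Metric.ball 0 r := by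
    apply IsPreconnected.subset_left_of_subset_union hu hv.isOpen_compl _ _
      ⟨g a, left_mem_segment ℝ _ _, mem_image_of_mem g (mem_ball_zero_iff.2 har)⟩
      (convex_segment _ _).isPreconnected
    · rw [disjoint_compl_right_iff_subset]
      exact image_mono Metric.ball_subset_closedBall
    · intro x hx
      by_cases hxK : x ∈ g '' Metric.closedBall 0 r
      · left
        obtain ⟨z, hz, rfl⟩ := hxK
        rw [mem_closedBall_zero_iff] at hz
        refine mem_image_of_mem g (mem_ball_zero_iff.2 (lt_of_le_of_ne hz ?_))
        intro hzr
        have hzD := hsub (mem_closedBall_zero_iff.2 hz)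
        have h1 := re_sub_mul_conj_pos hg hg' hc hzD (hzr ▸ har.le) (by rintro rfl; exact har.ne hzr)
        have h2 := re_sub_mul_conj_pos hg hg' hc hzD (hzr ▸ hbr.le) (by rintro rfl; exact hbr.ne hzr)
        obtain ⟨s, t, hs, ht, hst, hx⟩ := hx
        set c := starRingEnd ℂ (z * deriv g z)
        have h3 : (s : ℂ) * ((g z - g a) * c) + t * ((g z - g b) * c) = 0 := by
          have hst' : (s : ℂ) + t = 1 := by exact_mod_cast hst
          have : (s : ℂ) * g a + t * g b = g z := by simpa using hx
          linear_combination (g z * c) * hst' - c * this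
        have h4 := congrArg Complex.re h3
        simp only [Complex.add_re, Complex.re_ofReal_mul, Complex.zero_re] at h4
        rcases hs.eq_or_lt with h | h
        · have : t = 1 := by linarith
          rw [← h, this] at h4; linarith
        · have := mul_pos h h1
          have := mul_nonneg ht h2.le
          linarith
      · exact Or.inr hxK
  exact key.trans (image_mono hbs)

/-! ### Close-to-convex functions and the chain T + s z g' -/

/-- Let d = g(z₀) - g(z₁). Integrating h ∘ g⁻¹ along the segment from g(z₁) to g(z₀), which lies in
the convex image, gives Re ((h(z₀) - h(z₁)) conj d) > 0. The supporting line gives Re (z₀ g'(z₀)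
conj d) > 0, so the equation with t ≥ 0 has contradictory signs. -/
theorem eq_of_apply_eq_add_normal {g h : ℂ → ℂ} (hg : AnalyticOnNhd ℂ g unitDisk)
    (hg' : ∀ z ∈ unitDisk, deriv g z ≠ 0)
    (hc : ∀ z ∈ unitDisk, 0 < (1 + z * deriv (deriv g) z / deriv g z).re)
    (hh : AnalyticOnNhd ℂ h unitDisk) (hhg : ∀ z ∈ unitDisk, 0 < (deriv h z / deriv g z).re)
    {z₀ z₁ : ℂ} (h0 : z₀ ∈ unitDisk) (h01 : ‖z₁‖ ≤ ‖z₀‖) {t : ℝ} (ht : 0 ≤ t)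
    (heq : h z₁ = h z₀ + t * (z₀ * deriv g z₀)) : z₁ = z₀ := by
  by_contra hne
  have h1 : z₁ ∈ unitDisk := mem_unitDisk.2 (h01.trans_lt (mem_unitDisk.1 h0))
  obtain ⟨-, k, -, hkg, hkd⟩ := hg.exists_inverse_of_injOn isOpen_unitDisk (injOn_of_convex hg hg' hc)
  set d := g z₀ - g z₁ with hd
  have hpos := re_sub_mul_conj_pos hg hg' hc h0 h01 hne
  have hd0 : d ≠ 0 := by
    intro h
    rw [← hd, h] at hpos
    simp at hpos
  have hdn : 0 < Complex.normSq d := Complex.normSq_pos.2 hd0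
  have hpath : ∀ s ∈ Icc (0 : ℝ) 1, g z₁ + s * d ∈ g '' unitDisk := by
    intro s hs
    apply (convex_image_unitDisk hg hg' hc).segment_subset
      (mem_image_of_mem g h1) (mem_image_of_mem g h0)
    refine ⟨1 - s, s, by linarith [hs.2], hs.1, by ring, ?_⟩
    simp only [hd, Complex.real_smul]
    push_cast
    ring
  have hφ : ∀ s ∈ Icc (0 : ℝ) 1, ∃ y > 0,
      HasDerivAt (fun s : ℝ => (h (k (g z₁ + s * d)) * starRingEnd ℂ d).re) y s := by
    intro s hs
    obtain ⟨z, hz, hzs⟩ := hpath s hs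
    have h2 : HasDerivAt (fun s : ℝ => g z₁ + s * d) (1 * d) s :=
      ((Complex.ofRealCLM.hasDerivAt (x := s)).mul_const d).const_add (g z₁)
    have h3 : HasDerivAt k (deriv g z)⁻¹ (g z₁ + s * d) := hzs ▸ hkd z hz
    have hkz : k (g z₁ + s * d) = z := by rw [← hzs, hkg z hz]
    have h4 : HasDerivAt h (deriv h z) (k (g z₁ + s * d)) := by
      rw [hkz]; exact (hh z hz).differentiableAt.hasDerivAt
    have h45 : HasDerivAt (fun w => h (k w)) (deriv h z * (deriv g z)⁻¹) (g z₁ + s * d) :=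
      HasDerivAt.comp _ h4 h3
    have h5 : HasDerivAt (fun s : ℝ => h (k (g z₁ + s * d)))
        (deriv h z * (deriv g z)⁻¹ * (1 * d)) s := by
      have h8 := h45.comp s h2
      exact h8
    have h6 : HasDerivAt (fun s : ℝ => (h (k (g z₁ + s * d)) * starRingEnd ℂ d).re) _ s :=
      Complex.reCLM.hasFDerivAt.comp_hasDerivAt s (h5.mul_const (starRingEnd ℂ d))
    refine ⟨_, ?_, h6⟩
    have h7 : deriv h z * (deriv g z)⁻¹ * (1 * d) * starRingEnd ℂ d
        = (Complex.normSq d : ℂ) * (deriv h z / deriv g z) := by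
      rw [Complex.normSq_eq_conj_mul_self]; ring
    rw [h7, Complex.reCLM_apply, Complex.re_ofReal_mul]
    exact mul_pos hdn (hhg z hz)
  have hmono : StrictMonoOn (fun s : ℝ => (h (k (g z₁ + s * d)) * starRingEnd ℂ d).re)
      (Icc 0 1) := by
    apply strictMonoOn_of_deriv_pos (convex_Icc _ _)
    · intro s hs
      obtain ⟨y, -, hy⟩ := hφ s hs
      exact hy.continuousAt.continuousWithinAt
    · intro s hs
      obtain ⟨y, hy0, hy⟩ := hφ s (interior_subset hs)
      rw [hy.deriv]; exact hy0
  have h2 := hmono (left_mem_Icc.2 zero_le_one) (right_mem_Icc.2 zero_le_one) zero_lt_one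
  have e1 : g z₁ + ((1 : ℝ) : ℂ) * d = g z₀ := by simp [hd]
  have e0 : g z₁ + ((0 : ℝ) : ℂ) * d = g z₁ := by simp
  simp only [e1, e0, hkg _ h0, hkg _ h1, heq, add_mul, Complex.add_re, mul_assoc,
    Complex.re_ofReal_mul] at h2
  have h3 : (z₀ * (deriv g z₀ * starRingEnd ℂ d)).re = (d * starRingEnd ℂ (z₀ * deriv g z₀)).re := by
    rw [← Complex.conj_re (d * _), map_mul, Complex.conj_conj]; congr 1; ring
  rw [h3] at h2
  have := mul_nonneg ht hpos.le
  linarith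

/-- Minimum modulus principle: without zeros, 1/f would violate the maximum principle. It serves to
continue a root under small perturbations. -/
theorem exists_zero_of_norm_lt {f : ℂ → ℂ} {r ε : ℝ} (hr : 0 < r)
    (hf : DifferentiableOn ℂ f (Metric.closedBall 0 r))
    (hε : ∀ z : ℂ, ‖z‖ = r → ε ≤ ‖f z‖) {z₀ : ℂ} (hz₀ : ‖z₀‖ ≤ r) (hlt : ‖f z₀‖ < ε) :
    ∃ z : ℂ, ‖z‖ ≤ r ∧ f z = 0 := by
  by_contra! hne
  have hε0 : 0 < ε := (norm_nonneg _).trans_lt hlt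
  have hd : DiffContOnCl ℂ (fun z => (f z)⁻¹) (Metric.ball 0 r) := by
    apply DifferentiableOn.diffContOnCl
    rw [closure_ball _ hr.ne']
    exact hf.inv fun z hz => hne z (mem_closedBall_zero_iff.1 hz)
  have := Complex.norm_le_of_forall_mem_frontier_norm_le Metric.isBounded_ball hd (C := ε⁻¹)
    (fun w hw => by
      rw [frontier_ball _ hr.ne', mem_sphere_zero_iff_norm] at hw
      rw [norm_inv]
      exact inv_anti₀ hε0 (hε w hw))
    (z := z₀) (by rw [closure_ball _ hr.ne', mem_closedBall_zero_iff]; exact hz₀)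
  rw [norm_inv, inv_le_inv₀ (norm_pos_iff.2 (hne z₀ hz₀)) hε0] at this
  exact absurd hlt this.not_gt

theorem hasDerivAt_add_mul_normal {g T : ℂ → ℂ} (hg : AnalyticOnNhd ℂ g unitDisk)
    (hT : AnalyticOnNhd ℂ T unitDisk) (s : ℝ) {z : ℂ} (hz : z ∈ unitDisk) :
    HasDerivAt (fun z => T z + s * (z * deriv g z))
      (deriv T z + s * (deriv g z + z * deriv (deriv g) z)) z := by
  have h1 : HasDerivAt (fun z : ℂ => z * deriv g z) (1 * deriv g z + z * deriv (deriv g) z) z :=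
    (hasDerivAt_id z).mul (hg.deriv z hz).differentiableAt.hasDerivAt
  refine ((hT z hz).differentiableAt.hasDerivAt.add (h1.const_mul (s : ℂ))).congr_deriv ?_
  ring

theorem re_deriv_div_pos {g T : ℂ → ℂ} (hg : AnalyticOnNhd ℂ g unitDisk)
    (hg' : ∀ z ∈ unitDisk, deriv g z ≠ 0)
    (hc : ∀ z ∈ unitDisk, 0 < (1 + z * deriv (deriv g) z / deriv g z).re)
    (hT : AnalyticOnNhd ℂ T unitDisk) (hTg : ∀ z ∈ unitDisk, 0 < (deriv T z / deriv g z).re)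
    {s : ℝ} (hs : 0 ≤ s) {z : ℂ} (hz : z ∈ unitDisk) :
    0 < (deriv (fun z => T z + s * (z * deriv g z)) z / deriv g z).re := by
  have h1 : (deriv T z + s * (deriv g z + z * deriv (deriv g) z)) / deriv g z
      = deriv T z / deriv g z + s * (1 + z * deriv (deriv g) z / deriv g z) := by
    have := hg' z hz
    field_simp
  rw [(hasDerivAt_add_mul_normal hg hT s hz).deriv, h1, Complex.add_re, Complex.re_ofReal_mul]
  have := mul_nonneg hs (hc z hz).le
  linarith [hTg z hz]

theorem analyticOnNhd_add_mul_normal {g T : ℂ → ℂ} (hg : AnalyticOnNhd ℂ g unitDisk)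
    (hT : AnalyticOnNhd ℂ T unitDisk) (s : ℝ) :
    AnalyticOnNhd ℂ (fun z => T z + s * (z * deriv g z)) unitDisk :=
  hT.add (analyticOnNhd_const.mul (analyticOnNhd_id.mul hg.deriv))

/-- The images of |z| < ρ under T + x z g' grow with x. Keep the value w fixed and raise x from s to
1: no root can escape through |z| = ρ, so the set of x with a root is closed and open to the right.
-/
theorem exists_apply_eq_of_chain {g T : ℂ → ℂ} (hg : AnalyticOnNhd ℂ g unitDisk)
    (hg' : ∀ z ∈ unitDisk, deriv g z ≠ 0)
    (hc : ∀ z ∈ unitDisk, 0 < (1 + z * deriv (deriv g) z / deriv g z).re)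
    (hT : AnalyticOnNhd ℂ T unitDisk) (hTg : ∀ z ∈ unitDisk, 0 < (deriv T z / deriv g z).re)
    {s : ℝ} (hs : 0 ≤ s) (hs1 : s ≤ 1) {ρ : ℝ} (hρ : ρ < 1) {z₀ : ℂ} (hz₀ : ‖z₀‖ < ρ) :
    ∃ z : ℂ, ‖z‖ < ρ ∧ T z + z * deriv g z = T z₀ + s * (z₀ * deriv g z₀) := by
  set w := T z₀ + s * (z₀ * deriv g z₀) with hw
  have hρ0 : 0 < ρ := (norm_nonneg _).trans_lt hz₀
  have hsub : Metric.closedBall (0 : ℂ) ρ ⊆ unitDisk := fun z hz =>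
    mem_unitDisk.2 ((mem_closedBall_zero_iff.1 hz).trans_lt hρ)
  -- A root on the circle would make w = T z₀ + s z₀ g'(z₀) an outward displacement, by x - s ≥ 0
  -- normals, of the value of the same member of the chain at z; the close-to-convex lemma forces z
  -- = z₀.
  have hsphere : ∀ x : ℝ, s ≤ x → ∀ z : ℂ, ‖z‖ = ρ → T z + x * (z * deriv g z) ≠ w := by
    intro x hx z hz heq
    have := eq_of_apply_eq_add_normal hg hg' hc (analyticOnNhd_add_mul_normal hg hT s)
      (fun z hz => re_deriv_div_pos hg hg' hc hT hTg hs hz)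
      (hsub (mem_closedBall_zero_iff.2 hz.le)) (z₁ := z₀) (hz ▸ hz₀.le) (sub_nonneg.2 hx)
      (by rw [← hw, ← heq]; push_cast; ring)
    rw [this] at hz₀
    exact hz₀.ne hz
  have hcont : ContinuousOn (fun y : ℝ × ℂ => T y.2 + y.1 * (y.2 * deriv g y.2) - w)
      (Icc s 1 ×ˢ Metric.closedBall 0 ρ) := by
    have hmt : MapsTo Prod.snd (Icc s 1 ×ˢ Metric.closedBall (0 : ℂ) ρ) unitDisk :=
      fun y hy => hsub hy.2
    have hT' := hT.continuousOn.comp continuousOn_snd hmt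
    have hg'' := hg.deriv.continuousOn.comp continuousOn_snd hmt
    have h1 : ContinuousOn (fun y : ℝ × ℂ => (y.1 : ℂ)) (Icc s 1 ×ˢ Metric.closedBall (0 : ℂ) ρ) :=
      (Complex.continuous_ofReal.comp continuous_fst).continuousOn
    exact (hT'.add (h1.mul (continuousOn_snd.mul hg''))).sub continuousOn_const
  -- Compactness makes the absence of boundary roots uniform in x, so one step size works in the
  -- minimum modulus argument.
  obtain ⟨ε, hε0, hε⟩ : ∃ ε > 0, ∀ x ∈ Icc s 1, ∀ z : ℂ, ‖z‖ = ρ →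
      ε ≤ ‖T z + x * (z * deriv g z) - w‖ := by
    have hK : IsCompact (Icc s 1 ×ˢ Metric.sphere (0 : ℂ) ρ) := isCompact_Icc.prod (isCompact_sphere _ _)
    have hne : (Icc s 1 ×ˢ Metric.sphere (0 : ℂ) ρ).Nonempty :=
      ⟨(s, ρ), left_mem_Icc.2 hs1, by simp [abs_of_pos hρ0]⟩
    obtain ⟨⟨x, z⟩, ⟨hx, hz⟩, hmin⟩ := hK.exists_isMinOn hne
      ((hcont.mono (prod_mono_right Metric.sphere_subset_closedBall)).norm)
    refine ⟨_, norm_pos_iff.2 (sub_ne_zero.2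
      (hsphere x hx.1 z (mem_sphere_zero_iff_norm.1 hz))), fun x' hx' z' hz' => ?_⟩
    exact hmin (show (x', z') ∈ _ from ⟨hx', mem_sphere_zero_iff_norm.2 hz'⟩)
  set S : Set ℝ := Prod.fst '' ((Icc s 1 ×ˢ Metric.closedBall (0 : ℂ) ρ) ∩
    (fun y : ℝ × ℂ => T y.2 + y.1 * (y.2 * deriv g y.2) - w) ⁻¹' {0}) with hS
  have hSmem : ∀ x, x ∈ S ↔ x ∈ Icc s 1 ∧ ∃ z : ℂ, ‖z‖ ≤ ρ ∧ T z + x * (z * deriv g z) - w = 0 := by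
    intro x
    simp only [hS, mem_image, mem_inter_iff, mem_prod, mem_closedBall_zero_iff, mem_preimage,
      mem_singleton_iff, Prod.exists, exists_and_right, exists_eq_right]
    constructor
    · rintro ⟨z, ⟨hx, hz⟩, h⟩; exact ⟨hx, z, hz, h⟩
    · rintro ⟨hx, z, hz, h⟩; exact ⟨z, ⟨hx, hz⟩, h⟩
  have hSc : IsClosed S := by
    have hK : IsCompact (Icc s 1 ×ˢ Metric.closedBall (0 : ℂ) ρ) :=
      isCompact_Icc.prod (isCompact_closedBall _ _)
    have hcl := hcont.preimage_isClosed_of_isClosed hK.isClosed (isClosed_singleton (x := (0 : ℂ)))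
    exact ((hK.of_isClosed_subset hcl inter_subset_left).image continuous_fst).isClosed
  obtain ⟨M, hM⟩ : ∃ M : ℝ, ∀ z ∈ Metric.closedBall (0 : ℂ) ρ, ‖z * deriv g z‖ ≤ M :=
    (isCompact_closedBall 0 ρ).exists_bound_of_continuousOn
      ((analyticOnNhd_id.mul hg.deriv).continuousOn.mono hsub)
  have hall : Icc s 1 ⊆ S := by
    apply IsClosed.Icc_subset_of_forall_mem_nhdsWithin (hSc.inter isClosed_Icc)
    · exact (hSmem s).2 ⟨left_mem_Icc.2 hs1, z₀, hz₀.le, sub_self _⟩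
    · rintro x ⟨hxS, hxI⟩
      obtain ⟨-, z, hz, hzx⟩ := (hSmem x).1 hxS
      have hev : ∀ᶠ y in 𝓝[>] x, |y - x| * |M| < ε := by
        have h1 : Continuous fun y : ℝ => |y - x| * |M| := by fun_prop
        have h2 := h1.tendsto x
        simp only [sub_self, abs_zero, zero_mul] at h2
        exact (h2.eventually (gt_mem_nhds hε0)).filter_mono nhdsWithin_le_nhds
      filter_upwards [hev, Ioo_mem_nhdsGT hxI.2] with y hy hyI
      have hyI' : y ∈ Icc s 1 := ⟨hxI.1.trans hyI.1.le, hyI.2.le⟩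
      refine (hSmem y).2 ⟨hyI', ?_⟩
      refine exists_zero_of_norm_lt hρ0 ?_ (hε y hyI') hz ?_
      · exact ((analyticOnNhd_add_mul_normal hg hT y).differentiableOn.mono hsub).sub_const w
      · have h1 : T z + y * (z * deriv g z) - w = ((y - x : ℝ) : ℂ) * (z * deriv g z) := by
          push_cast; linear_combination hzx
        rw [h1, norm_mul, Complex.norm_real, Real.norm_eq_abs]
        refine lt_of_le_of_lt ?_ hy
        gcongr
        exact (hM z (mem_closedBall_zero_iff.2 hz)).trans (le_abs_self M)
  obtain ⟨-, z, hz, hz1⟩ := (hSmem 1).1 (hall (right_mem_Icc.2 hs1))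
  refine ⟨z, lt_of_le_of_ne hz fun h => hsphere 1 hs1 z h (sub_eq_zero.1 hz1), ?_⟩
  have := sub_eq_zero.1 hz1
  simpa using this

/-! ### Jack's lemma and first contact -/

/-- By Schwarz, V(w) = W(z₀ eʷ) / (W(z₀) eʷ) is bounded by 1 on the left half-plane, and V(0) = 1.
So Re V is maximal at 0, and testing V'(0) = z₀ A / W(z₀) - 1 in the directions -1 and ±i shows that
it is real and nonnegative. -/
theorem jack_lemma {W : ℂ → ℂ} {r ρ : ℝ} (hr : 0 < r) (hρ : 0 < ρ) (h0 : W 0 = 0)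
    (hd : DifferentiableOn ℂ W (Metric.ball 0 r))
    (hle : ∀ z, ‖z‖ ≤ r → ‖W z‖ ≤ ρ) {z₀ A : ℂ} (hz₀ : ‖z₀‖ = r) (hW : ‖W z₀‖ = ρ)
    (hA : HasDerivAt W A z₀) : ∃ m : ℝ, 1 ≤ m ∧ z₀ * A = m * W z₀ := by
  have hW0 : W z₀ ≠ 0 := norm_pos_iff.1 (hW ▸ hρ)
  have hschwarz : ∀ z, ‖z‖ ≤ r → ‖W z‖ ≤ ρ / r * ‖z‖ := by
    intro z hz
    rcases hz.eq_or_lt with h | h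
    · rw [h, div_mul_cancel₀ _ hr.ne']; exact hle z hz
    · have := Complex.dist_le_div_mul_dist_of_mapsTo_ball (R₂ := ρ) hd
        (fun z hz => by
          rw [h0, mem_closedBall_zero_iff]
          exact hle z (mem_ball_zero_iff.1 hz).le) (mem_ball_zero_iff.2 h)
      simpa [h0] using this
  set V : ℂ → ℂ := fun w => W (z₀ * Complex.exp w) * ((W z₀)⁻¹ * Complex.exp (-w)) with hV
  have hVd : HasDerivAt V (z₀ * A / W z₀ - 1) 0 := by
    have h1 : HasDerivAt (fun w => z₀ * Complex.exp w) (z₀ * Complex.exp 0) 0 :=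
      (Complex.hasDerivAt_exp 0).const_mul z₀
    have h2 : HasDerivAt W A (z₀ * Complex.exp 0) := by simpa using hA
    have h3 : HasDerivAt (fun w => W (z₀ * Complex.exp w)) _ 0 := HasDerivAt.comp 0 h2 h1
    have h4 : HasDerivAt (fun w : ℂ => (W z₀)⁻¹ * Complex.exp (-w)) _ 0 :=
      ((hasDerivAt_neg (0 : ℂ)).cexp).const_mul (W z₀)⁻¹
    have h5 : HasDerivAt V _ 0 := h3.mul h4
    refine h5.congr_deriv ?_
    simp only [Complex.exp_zero, neg_zero, mul_one]
    field_simp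
    ring
  have hmax : IsLocalMaxOn (fun w => (V w).re) {w : ℂ | w.re ≤ 0} 0 := by
    apply IsMaxOn.localize
    intro w hw
    have hw' : ‖z₀ * Complex.exp w‖ ≤ r := by
      rw [norm_mul, hz₀, Complex.norm_exp]
      exact mul_le_of_le_one_right hr.le (Real.exp_le_one_iff.2 hw)
    have h1 := hschwarz _ hw'
    have h2 : ‖V w‖ ≤ 1 := by
      have he := Real.exp_pos w.re
      simp only [hV, norm_mul, norm_inv, hW, Complex.norm_exp, Complex.neg_re, Real.exp_neg]
      rw [norm_mul, hz₀, Complex.norm_exp] at h1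
      calc ‖W (z₀ * Complex.exp w)‖ * (ρ⁻¹ * (Real.exp w.re)⁻¹)
          ≤ ρ / r * (r * Real.exp w.re) * (ρ⁻¹ * (Real.exp w.re)⁻¹) := by gcongr
        _ = 1 := by field_simp
    have h3 : V 0 = 1 := by simp [hV, hW0]
    change (V w).re ≤ (V 0).re
    rw [h3]
    exact (Complex.re_le_norm _).trans h2
  have hfd : HasFDerivWithinAt (fun w => (V w).re)
      (Complex.reCLM.comp ((z₀ * A / W z₀ - 1) • (1 : ℂ →L[ℝ] ℂ))) {w : ℂ | w.re ≤ 0} 0 :=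
    (Complex.reCLM.hasFDerivAt.comp 0 hVd.complexToReal_fderiv).hasFDerivWithinAt
  have hdir : ∀ y : ℂ, y.re ≤ 0 → ((z₀ * A / W z₀ - 1) * y).re ≤ 0 := by
    intro y hy
    have := hmax.hasFDerivWithinAt_nonpos hfd (y := y)
      (mem_posTangentConeAt_of_segment_subset ?_)
    · simpa using this
    · apply (convex_halfSpace_re_le (0 : ℝ)).segment_subset
      · simp
      · simpa using hy
  set c := z₀ * A / W z₀ - 1 with hc
  have h1 := hdir (-1) (by simp)
  have h2 := hdir Complex.I (by simp)
  have h3 := hdir (-Complex.I) (by simp)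
  simp at h1 h2 h3
  have him : c.im = 0 := le_antisymm h3 h2
  refine ⟨1 + c.re, by linarith, ?_⟩
  have h4 : c = (c.re : ℂ) := Complex.ext (by simp) (by simp [him])
  push_cast
  rw [← h4, hc]
  field_simp
  ring

/-- Take z₀ of least modulus with f(z₀) outside the image under k of the disc of radius ρ; then
Jack's lemma applies to k⁻¹ ∘ f on the closed disc through z₀. -/
theorem exists_boundary_contact {f k : ℂ → ℂ} (hf : AnalyticOnNhd ℂ f unitDisk)
    (hk : AnalyticOnNhd ℂ k unitDisk) (hinj : InjOn k unitDisk) (h0 : f 0 = k 0) {ρ : ℝ}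
    (hρ : ρ < 1) {zs : ℂ} (hzs : ‖zs‖ < ρ) (hnot : f zs ∉ k '' Metric.ball 0 ρ) :
    ∃ (z₀ ζ₀ : ℂ) (m : ℝ), ‖z₀‖ < ρ ∧ ‖ζ₀‖ = ρ ∧ 1 ≤ m ∧ f z₀ = k ζ₀ ∧
      z₀ * deriv f z₀ = m * (ζ₀ * deriv k ζ₀) := by
  have hρ0 : 0 < ρ := (norm_nonneg _).trans_lt hzs
  have hsub : Metric.closedBall (0 : ℂ) ρ ⊆ unitDisk := fun z hz =>
    mem_unitDisk.2 ((mem_closedBall_zero_iff.1 hz).trans_lt hρ)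
  have hbs : Metric.ball (0 : ℂ) ρ ⊆ unitDisk := Metric.ball_subset_closedBall.trans hsub
  have hso : IsOpen (k '' Metric.ball 0 ρ) :=
    ((hk.mono hbs).exists_inverse_of_injOn Metric.isOpen_ball (hinj.mono hbs)).1
  have hKc : IsClosed (k '' Metric.closedBall 0 ρ) :=
    ((isCompact_closedBall 0 ρ).image_of_continuousOn (hk.continuousOn.mono hsub)).isClosed
  have hzsub : Metric.closedBall (0 : ℂ) ‖zs‖ ⊆ unitDisk :=
    (Metric.closedBall_subset_closedBall hzs.le).trans hsub
  have hCc : IsCompact (Metric.closedBall (0 : ℂ) ‖zs‖ ∩ f ⁻¹' (k '' Metric.ball 0 ρ)ᶜ) :=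
    (isCompact_closedBall 0 ‖zs‖).of_isClosed_subset
      ((hf.continuousOn.mono hzsub).preimage_isClosed_of_isClosed Metric.isClosed_closedBall
        hso.isClosed_compl) inter_subset_left
  obtain ⟨z₀, ⟨hz₀b, hz₀⟩, hmin⟩ := hCc.exists_isMinOn
    ⟨zs, mem_closedBall_zero_iff.2 le_rfl, hnot⟩ continuous_norm.continuousOn
  rw [mem_closedBall_zero_iff] at hz₀b
  have hz₀ρ : ‖z₀‖ < ρ := hz₀b.trans_lt hzs
  have hin : ∀ z, ‖z‖ < ‖z₀‖ → f z ∈ k '' Metric.ball 0 ρ := by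
    intro z hz
    by_contra hzn
    exact (hmin (show z ∈ _ from ⟨mem_closedBall_zero_iff.2 (hz.le.trans hz₀b), hzn⟩)).not_gt hz
  have hz₀0 : 0 < ‖z₀‖ := by
    rw [norm_pos_iff]
    rintro rfl
    exact hz₀ ⟨0, Metric.mem_ball_self hρ0, h0.symm⟩
  have hD : ∀ z : ℂ, ‖z‖ ≤ ‖z₀‖ → z ∈ unitDisk := fun z hz =>
    hsub (mem_closedBall_zero_iff.2 (hz.trans hz₀ρ.le))
  have hin' : ∀ z, ‖z‖ ≤ ‖z₀‖ → f z ∈ k '' Metric.closedBall 0 ρ := by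
    intro z hz
    have hcl : z ∈ closure (Metric.ball (0 : ℂ) ‖z₀‖) := by
      rw [closure_ball _ hz₀0.ne', mem_closedBall_zero_iff]; exact hz
    have h1 := ((hf z (hD z hz)).continuousAt.continuousWithinAt
      (s := Metric.ball (0 : ℂ) ‖z₀‖)).mem_closure_image hcl
    refine closure_minimal ?_ hKc h1
    rintro _ ⟨x, hx, rfl⟩
    exact image_mono Metric.ball_subset_closedBall (hin x (mem_ball_zero_iff.1 hx))
  obtain ⟨ζ₀, hζ₀, hkζ⟩ := hin' z₀ le_rfl
  rw [mem_closedBall_zero_iff] at hζ₀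
  have hζρ : ‖ζ₀‖ = ρ := by
    refine hζ₀.eq_of_not_lt fun h => hz₀ ⟨ζ₀, mem_ball_zero_iff.2 h, hkζ⟩
  have hζD : ζ₀ ∈ unitDisk := hsub (mem_closedBall_zero_iff.2 hζ₀)
  obtain ⟨-, κ, hκ, hκk, hκd⟩ := hk.exists_inverse_of_injOn isOpen_unitDisk hinj
  have hWd : ∀ z, ‖z‖ ≤ ‖z₀‖ → DifferentiableAt ℂ (fun z => κ (f z)) z := fun z hz =>
    (hκ (f z) (image_mono hsub (hin' z hz))).differentiableAt.comp z
      (hf z (hD z hz)).differentiableAt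
  have hWz₀ : κ (f z₀) = ζ₀ := by rw [← hkζ, hκk _ hζD]
  obtain ⟨m, hm, hmeq⟩ := jack_lemma (W := fun z => κ (f z)) (r := ‖z₀‖) (ρ := ρ) hz₀0 hρ0
    (by simp only [h0]; exact hκk 0 zero_mem_unitDisk)
    (fun z hz => (hWd z (mem_ball_zero_iff.1 hz).le).differentiableWithinAt)
    (fun z hz => by
      obtain ⟨x, hx, hxz⟩ := hin' z hz
      simp only [← hxz, hκk x (hsub hx)]
      exact mem_closedBall_zero_iff.1 hx) rfl (by simp only [hWz₀]; exact hζρ)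
    (HasDerivAt.comp z₀ (hkζ ▸ hκd ζ₀ hζD) (hf z₀ (hD z₀ le_rfl)).differentiableAt.hasDerivAt)
  refine ⟨z₀, ζ₀, m, hz₀ρ, hζρ, hm, hkζ.symm, ?_⟩
  have hk0 : deriv k ζ₀ ≠ 0 := deriv_ne_zero_of_injOn (hk ζ₀ hζD) (isOpen_unitDisk.mem_nhds hζD) hinj
  simp only [hWz₀] at hmeq
  field_simp at hmeq
  linear_combination hmeq

/-! ### The differential expression in logarithmic coordinates -/

noncomputable section

/-- `ℓ` is the analytic logarithm of `p` in the unit disk that vanishes at `0`. -/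
structure IsDiskLog (ℓ p : ℂ → ℂ) : Prop where
  analytic : AnalyticOnNhd ℂ ℓ unitDisk
  map_zero : ℓ 0 = 0
  exp_eq : ∀ z ∈ unitDisk, Complex.exp (ℓ z) = p z

/-- `p^(α/μ+1) + δ p^(α/μ) + p^(α/μ) z p' / (β p + γ)`, with powers formed by `ℓ = log p`. -/
def powerExpr (α : ℝ) (β γ δ : ℂ) (μ : ℝ) (ℓ p : ℂ → ℂ) (z : ℂ) : ℂ :=
  Complex.exp (((α / μ + 1 : ℝ) : ℂ) * ℓ z) + δ * Complex.exp (((α / μ : ℝ) : ℂ) * ℓ z)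
    + Complex.exp (((α / μ : ℝ) : ℂ) * ℓ z) * bbTerm β γ p z

/-- The value of `powerExpr` in terms of `x = log p` and `y = z (log p)'`. -/
def logSymbol (a : ℝ) (β γ δ x y : ℂ) : ℂ :=
  Complex.exp (((a + 1 : ℝ) : ℂ) * x) + δ * Complex.exp ((a : ℂ) * x)
    + Complex.exp (((a + 1 : ℝ) : ℂ) * x) / (β * Complex.exp x + γ) * y

variable {α μ : ℝ} {β γ δ : ℂ}

theorem exp_succ_mul (a : ℝ) (x : ℂ) :
    Complex.exp (((a + 1 : ℝ) : ℂ) * x) = Complex.exp ((a : ℂ) * x) * Complex.exp x := by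
  rw [← Complex.exp_add]; congr 1; push_cast; ring

theorem IsDiskLog.deriv_eq {ℓ p : ℂ → ℂ} (h : IsDiskLog ℓ p) {z : ℂ} (hz : z ∈ unitDisk) :
    deriv p z = p z * deriv ℓ z := by
  have h1 : HasDerivAt (fun z => Complex.exp (ℓ z)) (Complex.exp (ℓ z) * deriv ℓ z) z :=
    (h.analytic z hz).differentiableAt.hasDerivAt.cexp
  have h2 : (fun z => Complex.exp (ℓ z)) =ᶠ[𝓝 z] p := by
    filter_upwards [isOpen_unitDisk.mem_nhds hz] with x hx using h.exp_eq x hx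
  rw [← h2.deriv_eq, h1.deriv, h.exp_eq z hz]

theorem IsDiskLog.powerExpr_eq {ℓ p : ℂ → ℂ} (h : IsDiskLog ℓ p) {z : ℂ} (hz : z ∈ unitDisk) :
    powerExpr α β γ δ μ ℓ p z = logSymbol (α / μ) β γ δ (ℓ z) (z * deriv ℓ z) := by
  simp only [powerExpr, logSymbol, bbTerm]
  rw [h.deriv_eq hz, h.exp_eq z hz, exp_succ_mul, h.exp_eq z hz]
  ring

theorem IsDiskLog.injOn {ℓ p : ℂ → ℂ} (h : IsDiskLog ℓ p) (hp : InjOn p unitDisk) :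
    InjOn ℓ unitDisk := fun a ha b hb hab =>
  hp ha hb (by rw [← h.exp_eq a ha, ← h.exp_eq b hb, hab])

theorem ClassR.exists_isDiskLog {p : ℂ → ℂ} (hp : ClassR α β γ δ μ p) :
    ∃ ℓ, IsDiskLog ℓ p := by
  obtain ⟨ℓ, h1, h2, h3⟩ := hp.analytic.exists_log hp.ne_zero
  exact ⟨ℓ, h1, by rw [h2, hp.map_zero, Complex.log_one], h3⟩

theorem ClassR.analyticOnNhd_bbTerm {p : ℂ → ℂ} (hp : ClassR α β γ δ μ p) :
    AnalyticOnNhd ℂ (bbTerm β γ p) unitDisk :=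
  (analyticOnNhd_id.mul hp.analytic.deriv).div
    ((analyticOnNhd_const.mul hp.analytic).add analyticOnNhd_const) hp.denom_ne_zero

theorem ClassR.analyticOnNhd_powerExpr {ℓ p : ℂ → ℂ} (hp : ClassR α β γ δ μ p)
    (hℓ : IsDiskLog ℓ p) : AnalyticOnNhd ℂ (powerExpr α β γ δ μ ℓ p) unitDisk :=
  ((analyticOnNhd_const.mul hℓ.analytic).cexp.add
    (analyticOnNhd_const.mul (analyticOnNhd_const.mul hℓ.analytic).cexp)).add
    ((analyticOnNhd_const.mul hℓ.analytic).cexp.mul hp.analyticOnNhd_bbTerm)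

/-! ### From principal powers to analytic powers -/

theorem neg_pi_lt_log_mul_im (hμ : 0 < μ) (hμ1 : μ ≤ 1) (x : ℂ) :
    -Real.pi < (Complex.log x * μ).im ∧ (Complex.log x * μ).im ≤ μ * Real.pi := by
  have h1 := Complex.neg_pi_lt_arg x
  have h2 := Complex.arg_le_pi x
  have h3 := Real.pi_pos
  rw [Complex.im_mul_ofReal, Complex.log_im]
  constructor <;> nlinarith

theorem cpow_cpow_inv (hμ : 0 < μ) (hμ1 : μ ≤ 1) (x : ℂ) :
    (x ^ (μ : ℂ)) ^ (1 / (μ : ℂ)) = x := by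
  have h := neg_pi_lt_log_mul_im hμ hμ1 x
  have h3 := Real.pi_pos
  rw [← Complex.cpow_mul _ h.1 (by nlinarith)]
  have : (μ : ℂ) ≠ 0 := by exact_mod_cast hμ.ne'
  rw [mul_one_div_cancel this, Complex.cpow_one]

theorem arg_cpow_le (hμ : 0 < μ) (hμ1 : μ ≤ 1) (x : ℂ) : (x ^ (μ : ℂ)).arg ≤ μ * Real.pi := by
  have h3 := Real.pi_pos
  by_cases hx : x = 0
  · have : (μ : ℂ) ≠ 0 := by exact_mod_cast hμ.ne'
    rw [hx, Complex.zero_cpow this, Complex.arg_zero]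
    positivity
  · have h := neg_pi_lt_log_mul_im hμ hμ1 x
    rw [Complex.cpow_def_of_ne_zero hx, ← Complex.log_im, Complex.log_exp h.1 (by nlinarith)]
    exact h.2

/-- A function of the form `E ^ μ` with `0 < μ < 1` that is analytic at `0` is locally constant
if `E 0` lies on the nonpositive real axis. -/
theorem eventually_const_of_cpow_analyticAt (hμ : 0 < μ) (hμ1 : μ < 1) {E G : ℂ → ℂ}
    (hG : AnalyticAt ℂ G 0) (hE : ∀ᶠ z in 𝓝 0, G z = E z ^ (μ : ℂ))
    (h0 : E 0 ∉ Complex.slitPlane) : ∀ᶠ z in 𝓝 0, E z = E 0 := by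
  have hpi := Real.pi_pos
  have hμc : (μ : ℂ) ≠ 0 := by exact_mod_cast hμ.ne'
  rcases hG.eventually_constant_or_nhds_le_map_nhds with hc | hop
  · filter_upwards [hc, hE] with z h1 h2
    rw [← cpow_cpow_inv hμ hμ1.le (E z), ← cpow_cpow_inv hμ hμ1.le (E 0), ← h2, ← hE.self_of_nhds, h1]
  · exfalso
    have hev : ∀ᶠ w in 𝓝 (G 0), w.arg ≤ μ * Real.pi := by
      refine hop ?_
      change ∀ᶠ z in 𝓝 0, (G z).arg ≤ μ * Real.pi
      filter_upwards [hE] with z hz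
      rw [hz]; exact arg_cpow_le hμ hμ1.le _
    -- The arguments of μ-th powers are at most μπ < π. Larger ones occur arbitrarily near `G 0`: on
    -- the negative axis if `E 0 = 0`, and otherwise by rotating `G 0`, whose argument is exactly
    -- μπ.
    obtain ⟨c, hc, hcarg⟩ : ∃ c : ℝ → ℂ, Tendsto c (𝓝[>] 0) (𝓝 (G 0)) ∧
        ∀ᶠ t in 𝓝[>] (0 : ℝ), μ * Real.pi < (c t).arg := by
      by_cases hE0 : E 0 = 0
      · refine ⟨fun t => ((-t : ℝ) : ℂ), ?_, ?_⟩
        · have h1 : Continuous fun t : ℝ => ((-t : ℝ) : ℂ) := by fun_prop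
          have h2 := h1.tendsto 0
          rw [hE.self_of_nhds, hE0, Complex.zero_cpow hμc]
          simp only [neg_zero, Complex.ofReal_zero] at h2
          exact h2.mono_left nhdsWithin_le_nhds
        · filter_upwards [self_mem_nhdsWithin] with t ht
          rw [Complex.arg_ofReal_of_neg (neg_lt_zero.2 ht)]
          nlinarith
      · have harg : (E 0).arg = Real.pi := by
          by_contra hne
          exact h0 (Complex.mem_slitPlane_iff_arg.2 ⟨hne, hE0⟩)
        refine ⟨fun t => Complex.exp (Complex.log (E 0) * μ + t * Complex.I), ?_, ?_⟩
        · have h1 : Continuous fun t : ℝ => Complex.exp (Complex.log (E 0) * μ + t * Complex.I) := by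
            fun_prop
          have h2 := h1.tendsto 0
          rw [hE.self_of_nhds, Complex.cpow_def_of_ne_zero hE0]
          simp only [Complex.ofReal_zero, zero_mul, add_zero] at h2
          exact h2.mono_left nhdsWithin_le_nhds
        · have hpos : 0 < (1 - μ) * Real.pi := mul_pos (by linarith) hpi
          filter_upwards [Ioo_mem_nhdsGT hpos] with t ht
          have him : (Complex.log (E 0) * μ + t * Complex.I).im = μ * Real.pi + t := by
            rw [Complex.add_im, Complex.im_mul_ofReal, Complex.log_im, harg]
            simp [mul_comm]
          rw [← Complex.log_im, Complex.log_exp, him]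
          · linarith [ht.1]
          · rw [him]; nlinarith [ht.1]
          · rw [him]; nlinarith [ht.2]
    obtain ⟨t, h1, h2⟩ := ((hc.eventually hev).and hcarg).exists
    exact h1.not_gt h2

theorem eventually_exp_cpow {X : ℂ → ℂ} (hX : ContinuousAt X 0) (hX1 : -Real.pi < (X 0).im) (hX2 : (X 0).im < Real.pi) (c : ℂ) :
    ∀ᶠ z in 𝓝 0, Complex.exp (X z) ^ c = Complex.exp (X z * c) := by
  have h1 : ContinuousAt (fun z => (X z).im) 0 := Complex.continuous_im.continuousAt.comp hX
  filter_upwards [h1.eventually (lt_mem_nhds hX1), h1.eventually (gt_mem_nhds hX2)] with z h2 h3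
  rw [Complex.cpow_def_of_ne_zero (Complex.exp_ne_zero _), Complex.log_exp h2 h3.le]

open Classical in
/-- The function that recovers, near the origin, `powerExpr` from `diffExpr`. -/
def recoverPower (μ : ℝ) (δ x : ℂ) : ℂ :=
  if μ = 1 ∨ 1 + δ ∈ Complex.slitPlane then x ^ (1 / (μ : ℂ))
  else (1 + δ) * (x / (1 + δ) ^ (μ : ℂ)) ^ (1 / (μ : ℂ))

/-- Near 0 the base of the μ-th power is close to 1 + δ. Off the cut the root 1/μ undoes the power.
On the cut with μ < 1, analyticity forces the base to be constant; dividing by its power leaves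
e^{αℓ}, whose root is harmless because ℓ vanishes at 0. -/
theorem ClassR.eventually_powerExpr_eq {ℓ p : ℂ → ℂ} (hμ : 0 < μ) (hμ1 : μ ≤ 1)
    (hp : ClassR α β γ δ μ p) (hℓ : IsDiskLog ℓ p) :
    ∀ᶠ z in 𝓝 0, powerExpr α β γ δ μ ℓ p z = recoverPower μ δ (diffExpr α β γ δ μ p z) := by
  have hpi := Real.pi_pos
  have hμc : (μ : ℂ) ≠ 0 := by exact_mod_cast hμ.ne'
  have h00 : (0 : ℂ) ∈ unitDisk := zero_mem_unitDisk
  have hD : ∀ᶠ z in 𝓝 (0 : ℂ), z ∈ unitDisk := isOpen_unitDisk.mem_nhds h00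
  have hℓc : ContinuousAt ℓ 0 := (hℓ.analytic 0 h00).continuousAt
  set E : ℂ → ℂ := fun z => p z + δ + bbTerm β γ p z with hE
  have hEa : AnalyticAt ℂ E 0 :=
    ((hp.analytic 0 h00).add analyticAt_const).add (hp.analyticOnNhd_bbTerm 0 h00)
  have hE0 : E 0 = 1 + δ := by simp [hE, hp.map_zero, bbTerm]
  have hpow : ∀ᶠ z in 𝓝 0, p z ^ (α : ℂ) = Complex.exp (ℓ z * α) := by
    filter_upwards [hD, eventually_exp_cpow hℓc (by simpa [hℓ.map_zero] using hpi)
      (by simpa [hℓ.map_zero] using hpi) (α : ℂ)] with z hz h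
    rw [← hℓ.exp_eq z hz, h]
  have hF : ∀ᶠ z in 𝓝 0, powerExpr α β γ δ μ ℓ p z
      = Complex.exp (((α / μ : ℝ) : ℂ) * ℓ z) * E z := by
    filter_upwards [hD] with z hz
    simp only [powerExpr, hE]
    rw [exp_succ_mul, hℓ.exp_eq z hz]
    ring
  by_cases hcase : μ = 1 ∨ 1 + δ ∈ Complex.slitPlane
  · simp only [recoverPower, if_pos hcase]
    by_cases hm : μ = 1
    · subst hm
      filter_upwards [hpow, hF] with z h1 h2
      rw [h2, diffExpr, h1]
      simp [hE, mul_comm (α : ℂ)]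
    · have hs : E 0 ∈ Complex.slitPlane := hE0 ▸ hcase.resolve_left hm
      have hlog : ContinuousAt (fun z => Complex.log (E z)) 0 := hEa.continuousAt.clog hs
      have hX : ContinuousAt (fun z => ℓ z * α + Complex.log (E z) * μ) 0 :=
        (hℓc.mul continuousAt_const).add (hlog.mul continuousAt_const)
      have harg := Complex.mem_slitPlane_iff_arg.1 hs
      have h1 := Complex.neg_pi_lt_arg (E 0)
      have h2 : (E 0).arg < Real.pi := lt_of_le_of_ne (Complex.arg_le_pi _) harg.1
      have him : (ℓ 0 * α + Complex.log (E 0) * μ).im = (E 0).arg * μ := by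
        rw [hℓ.map_zero, zero_mul, zero_add, Complex.im_mul_ofReal, Complex.log_im]
      filter_upwards [hpow, hF, hEa.continuousAt.eventually_ne harg.2,
        eventually_exp_cpow hX (by rw [him]; nlinarith) (by rw [him]; nlinarith) (1 / (μ : ℂ))]
        with z h3 h4 h5 h6
      rw [h4, diffExpr, h3]
      change _ = (_ * E z ^ (μ : ℂ)) ^ (1 / (μ : ℂ))
      rw [Complex.cpow_def_of_ne_zero h5, ← Complex.exp_add, h6]
      have : (ℓ z * α + Complex.log (E z) * μ) * (1 / (μ : ℂ))
          = ((α / μ : ℝ) : ℂ) * ℓ z + Complex.log (E z) := by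
        push_cast; field_simp
      rw [this, Complex.exp_add, Complex.exp_log h5]
  · simp only [recoverPower, if_neg hcase]
    push Not at hcase
    obtain ⟨hm, hs⟩ := hcase
    have hconst : ∀ᶠ z in 𝓝 0, E z = E 0 := by
      apply eventually_const_of_cpow_analyticAt hμ (lt_of_le_of_ne hμ1 hm)
        (G := fun z => diffExpr α β γ δ μ p z * Complex.exp (-(ℓ z * α)))
      · exact (hp.expr_analytic 0 h00).mul
          ((hℓ.analytic 0 h00).mul analyticAt_const).neg.cexp
      · filter_upwards [hpow] with z hz
        rw [diffExpr, hz, Complex.exp_neg]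
        have := Complex.exp_ne_zero (ℓ z * α)
        field_simp
        rfl
      · rwa [hE0]
    filter_upwards [hpow, hF, hconst, eventually_exp_cpow (X := fun z => ℓ z * α)
      (hℓc.mul continuousAt_const) (by simpa [hℓ.map_zero] using hpi)
      (by simpa [hℓ.map_zero] using hpi) (1 / (μ : ℂ))] with z h1 h2 h3 h4
    rw [hE0] at h3
    rw [h2, diffExpr, h1]
    change _ = _ * (_ * E z ^ (μ : ℂ) / _) ^ (1 / (μ : ℂ))
    rw [h3]
    -- Here the base vanishes identically near 0, and both sides are 0.
    by_cases hδ : 1 + δ = 0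
    · simp [hδ]
    · have hne : (1 + δ) ^ (μ : ℂ) ≠ 0 := by
        rw [Complex.cpow_def_of_ne_zero hδ]; exact Complex.exp_ne_zero _
      rw [mul_div_cancel_right₀ _ hne, h4, mul_comm]
      congr 2
      push_cast; field_simp

theorem powerExpr_eq_comp {ℓ₁ p₁ ℓ₂ p₂ w : ℂ → ℂ} (hμ : 0 < μ) (hμ1 : μ ≤ 1)
    (hp₁ : ClassR α β γ δ μ p₁) (hℓ₁ : IsDiskLog ℓ₁ p₁)
    (hp₂ : ClassR α β γ δ μ p₂) (hℓ₂ : IsDiskLog ℓ₂ p₂)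
    (hw : AnalyticOnNhd ℂ w unitDisk) (hw0 : w 0 = 0) (hw1 : ∀ z ∈ unitDisk, ‖w z‖ < 1)
    (heq : ∀ z ∈ unitDisk, diffExpr α β γ δ μ p₁ z = diffExpr α β γ δ μ p₂ (w z)) :
    ∀ z ∈ unitDisk, powerExpr α β γ δ μ ℓ₁ p₁ z = powerExpr α β γ δ μ ℓ₂ p₂ (w z) := by
  have h00 := zero_mem_unitDisk
  have hwc : Tendsto w (𝓝 0) (𝓝 0) := by simpa [hw0] using (hw 0 h00).continuousAt.tendsto
  apply (hp₁.analyticOnNhd_powerExpr hℓ₁).eqOn_of_preconnected_of_eventuallyEq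
    (((hp₂.analyticOnNhd_powerExpr hℓ₂).comp hw fun z hz => mem_unitDisk.2 (hw1 z hz)) :
      AnalyticOnNhd ℂ (fun z => powerExpr α β γ δ μ ℓ₂ p₂ (w z)) unitDisk)
    isPreconnected_unitDisk h00
  filter_upwards [hp₁.eventually_powerExpr_eq hμ hμ1 hℓ₁,
    hwc.eventually (hp₂.eventually_powerExpr_eq hμ hμ1 hℓ₂), isOpen_unitDisk.mem_nhds h00]
    with z h1 h2 h3
  rw [h1, Function.comp_apply, h2, heq z h3]

/-! ### Subordination and superordination by contact -/

theorem norm_le_norm_of_schwarz {w : ℂ → ℂ} (hw : AnalyticOnNhd ℂ w unitDisk) (hw0 : w 0 = 0)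
    (hw1 : ∀ z ∈ unitDisk, ‖w z‖ < 1) {z : ℂ} (hz : z ∈ unitDisk) : ‖w z‖ ≤ ‖z‖ :=
  Complex.norm_le_norm_of_mapsTo_ball (R := 1) hw.differentiableOn
    (fun z hz => mem_closedBall_zero_iff.2 (hw1 z hz).le) hw0 (mem_unitDisk.1 hz)

theorem subordinate_of_image_subset {p q : ℂ → ℂ} (hp : AnalyticOnNhd ℂ p unitDisk)
    (hq : IsUnivalent q) (h0 : p 0 = q 0) (hpq : ∀ z ∈ unitDisk, p z ∈ q '' unitDisk) :
    Subordinate p q := by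
  obtain ⟨-, k, hk, hkq, -⟩ := hq.1.exists_inverse_of_injOn isOpen_unitDisk hq.2
  refine ⟨hp, hq.1, fun z => k (p z), hk.comp hp hpq, ?_, ?_, ?_⟩
  · simp only [h0]; exact hkq 0 zero_mem_unitDisk
  · intro z hz
    obtain ⟨x, hx, hxz⟩ := hpq z hz
    simp only [← hxz, hkq x hx]; exact mem_unitDisk.1 hx
  · intro z hz
    obtain ⟨x, hx, hxz⟩ := hpq z hz
    simp only [← hxz, hkq x hx]

/-- Translates the positivity conditions into geometry: the second is convexity of g, because z g' =
q^{α/μ} R, and the first is exactly Re (T'/g') > 0. -/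
theorem ClassR.exists_convex_chain {q v : ℂ → ℂ} (hq : ClassR α β γ δ μ q)
    (hu : IsUnivalent q) (hpos : PositivityConditions α β γ δ μ q) (hv : IsDiskLog v q) :
    ∃ g T : ℂ → ℂ, AnalyticOnNhd ℂ g unitDisk ∧ (∀ z ∈ unitDisk, deriv g z ≠ 0) ∧
      (∀ z ∈ unitDisk, 0 < (1 + z * deriv (deriv g) z / deriv g z).re) ∧
      AnalyticOnNhd ℂ T unitDisk ∧ (∀ z ∈ unitDisk, 0 < (deriv T z / deriv g z).re) ∧
      ∀ z ∈ unitDisk, ∀ s : ℂ, logSymbol (α / μ) β γ δ (v z) (s * (z * deriv v z))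
        = T z + s * (z * deriv g z) := by
  set a : ℝ := α / μ with ha
  have haC : (a : ℂ) = (α : ℂ) / μ := by rw [ha]; push_cast; rfl
  have hvinj := hv.injOn hu.2
  have hv' : ∀ z ∈ unitDisk, deriv v z ≠ 0 := fun z hz =>
    deriv_ne_zero_of_injOn (hv.analytic z hz) (isOpen_unitDisk.mem_nhds hz) hvinj
  set φ : ℂ → ℂ := fun z =>
    Complex.exp (((a + 1 : ℝ) : ℂ) * v z) / (β * q z + γ) * deriv v z with hφ
  have hφa : AnalyticOnNhd ℂ φ unitDisk :=
    ((analyticOnNhd_const.mul hv.analytic).cexp.div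
      ((analyticOnNhd_const.mul hq.analytic).add analyticOnNhd_const) hq.denom_ne_zero).mul
      hv.analytic.deriv
  have hφ0 : ∀ z ∈ unitDisk, φ z ≠ 0 := fun z hz =>
    mul_ne_zero (div_ne_zero (Complex.exp_ne_zero _) (hq.denom_ne_zero z hz)) (hv' z hz)
  obtain ⟨g, hg, -, hgd⟩ := hφa.exists_primitive 0
  have hgφ : ∀ z ∈ unitDisk, deriv g z = φ z := fun z hz => (hgd z hz).deriv
  have hgφ' : ∀ z ∈ unitDisk, deriv (deriv g) z = deriv φ z := by
    intro z hz
    apply Filter.EventuallyEq.deriv_eq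
    filter_upwards [isOpen_unitDisk.mem_nhds hz] with x hx using hgφ x hx
  set T : ℂ → ℂ := fun z =>
    Complex.exp (((a + 1 : ℝ) : ℂ) * v z) + δ * Complex.exp ((a : ℂ) * v z) with hT
  have hvd : ∀ z ∈ unitDisk, HasDerivAt v (deriv v z) z := fun z hz =>
    (hv.analytic z hz).differentiableAt.hasDerivAt
  refine ⟨g, T, hg, fun z hz => by rw [hgφ z hz]; exact hφ0 z hz, ?_, ?_, ?_, ?_⟩
  · intro z hz
    rw [hgφ z hz, hgφ' z hz]
    -- The second condition is not available at the origin, but there the convexity expression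
    -- equals 1.
    by_cases hz0 : z = 0
    · simp [hz0]
    · have hR : (fun z => z * φ z) =ᶠ[𝓝 z] fun z => Complex.exp ((a : ℂ) * v z) * bbTerm β γ q z := by
        filter_upwards [isOpen_unitDisk.mem_nhds hz] with x hx
        simp only [hφ, bbTerm]
        rw [exp_succ_mul, hv.exp_eq x hx, hv.deriv_eq hx]
        ring
      have h1 : HasDerivAt (fun z => z * φ z) (1 * φ z + z * deriv φ z) z :=
        (hasDerivAt_id z).mul (hφa z hz).differentiableAt.hasDerivAt
      have h2 : HasDerivAt (fun z => Complex.exp ((a : ℂ) * v z) * bbTerm β γ q z)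
          (Complex.exp ((a : ℂ) * v z) * (a * deriv v z) * bbTerm β γ q z
            + Complex.exp ((a : ℂ) * v z) * deriv (bbTerm β γ q) z) z :=
        ((hvd z hz).const_mul (a : ℂ)).cexp.mul
          (hq.analyticOnNhd_bbTerm z hz).differentiableAt.hasDerivAt
      have h3 := h1.deriv.symm.trans (hR.deriv_eq.trans h2.deriv)
      have h4 : z * φ z = Complex.exp ((a : ℂ) * v z) * bbTerm β γ q z := hR.self_of_nhds
      have h5 := hpos.second z hz hz0
      have hφz := hφ0 z hz
      have hR0 : bbTerm β γ q z ≠ 0 := by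
        intro h
        rw [h, mul_zero] at h4
        exact mul_ne_zero hz0 hφz h4
      have h6 : 1 + z * deriv φ z / φ z = (α : ℂ) / μ * (z * deriv q z / q z)
          + z * deriv (bbTerm β γ q) z / bbTerm β γ q z := by
        rw [hv.deriv_eq hz, ← haC]
        have hq0 := hq.ne_zero z hz
        have he := Complex.exp_ne_zero ((a : ℂ) * v z)
        have h7 : 1 + z * deriv φ z / φ z = z * (1 * φ z + z * deriv φ z) / (z * φ z) := by
          field_simp
        rw [h7, h3, h4]
        field_simp
      rw [h6]; exact h5
  · exact (analyticOnNhd_const.mul hv.analytic).cexp.add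
      (analyticOnNhd_const.mul (analyticOnNhd_const.mul hv.analytic).cexp)
  · intro z hz
    have h1 : HasDerivAt T (Complex.exp (((a + 1 : ℝ) : ℂ) * v z) * (((a + 1 : ℝ) : ℂ) * deriv v z)
        + δ * (Complex.exp ((a : ℂ) * v z) * (a * deriv v z))) z :=
      ((hvd z hz).const_mul _).cexp.add ((((hvd z hz).const_mul (a : ℂ)).cexp).const_mul δ)
    have hq0 := hq.ne_zero z hz
    have hd0 := hq.denom_ne_zero z hz
    have hv0 := hv' z hz
    have he := Complex.exp_ne_zero ((a : ℂ) * v z)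
    have h2 : deriv T z / deriv g z
        = (β * q z + γ) * (1 + (α : ℂ) / μ + (α : ℂ) * δ / (μ * q z)) := by
      rw [h1.deriv, hgφ z hz]
      simp only [hφ]
      rw [exp_succ_mul, hv.exp_eq z hz]
      have h3 : (α : ℂ) * δ / (μ * q z) = (a : ℂ) * δ / q z := by
        rw [haC]; field_simp
      rw [h3, ← haC]
      push_cast
      field_simp
      ring
    rw [h2]
    exact hpos.first z hz
  · intro z hz s
    rw [hgφ z hz]
    simp only [logSymbol, hT, hφ]
    rw [hv.exp_eq z hz]
    ring

/-- At a contact, F_q(w(z₀)) = F_p(z₀) = F_q(ζ₀) + (m - 1) ζ₀ g'(ζ₀) with m ≥ 1. This forces w(z₀) =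
ζ₀, against |w(z₀)| ≤ |z₀| < |ζ₀|. -/
theorem image_subset_of_subordination {p q u v w : ℂ → ℂ}
    (hu : IsDiskLog u p) (hv : IsDiskLog v q)
    (hq : ClassR α β γ δ μ q) (hqu : IsUnivalent q) (hpos : PositivityConditions α β γ δ μ q)
    (hw : AnalyticOnNhd ℂ w unitDisk) (hw0 : w 0 = 0) (hw1 : ∀ z ∈ unitDisk, ‖w z‖ < 1)
    (heq : ∀ z ∈ unitDisk, powerExpr α β γ δ μ u p z = powerExpr α β γ δ μ v q (w z)) :
    ∀ z ∈ unitDisk, p z ∈ q '' unitDisk := by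
  obtain ⟨g, T, hg, hg', hc, hT, hTg, hsym⟩ := hq.exists_convex_chain hqu hpos hv
  intro zs hzs
  -- A radius below 1 keeps the contact inside the disk, so no boundary behaviour is involved.
  obtain ⟨ρ, hzρ, hρ⟩ := exists_between (mem_unitDisk.1 hzs)
  suffices h : u zs ∈ v '' Metric.ball 0 ρ by
    obtain ⟨x, hx, hxz⟩ := h
    have hxD : x ∈ unitDisk := mem_unitDisk.2 ((mem_ball_zero_iff.1 hx).trans hρ)
    exact ⟨x, hxD, by rw [← hv.exp_eq x hxD, hxz, hu.exp_eq zs hzs]⟩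
  by_contra hnot
  obtain ⟨z₀, ζ₀, m, hz₀, hζ₀, hm, hval, hder⟩ := exists_boundary_contact hu.analytic hv.analytic
    (hv.injOn hqu.2) (by rw [hu.map_zero, hv.map_zero]) hρ hzρ hnot
  have hz₀D : z₀ ∈ unitDisk := mem_unitDisk.2 (hz₀.trans hρ)
  have hζD : ζ₀ ∈ unitDisk := mem_unitDisk.2 (hζ₀.trans_lt hρ)
  have hwD : w z₀ ∈ unitDisk := mem_unitDisk.2 (hw1 _ hz₀D)
  have hwz := norm_le_norm_of_schwarz hw hw0 hw1 hz₀D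
  have h1 := heq z₀ hz₀D
  rw [hu.powerExpr_eq hz₀D, hv.powerExpr_eq hwD, hval, hder, hsym ζ₀ hζD,
    ← one_mul (w z₀ * deriv v (w z₀)), hsym _ hwD] at h1
  have h2 := eq_of_apply_eq_add_normal hg hg' hc (analyticOnNhd_add_mul_normal hg hT 1)
    (fun z hz => re_deriv_div_pos hg hg' hc hT hTg zero_le_one hz) hζD (z₁ := w z₀)
    (by rw [hζ₀]; exact hwz.trans hz₀.le) (sub_nonneg.2 hm)
    (by push_cast; linear_combination -h1)
  rw [h2, hζ₀] at hwz
  exact hwz.not_gt hz₀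

/-- The contact now has q inside and p on the circle, so F_p(ζ₀) = T(z₀) + m⁻¹ z₀ g'(z₀). The chain
yields z₂ with |z₂| < ρ and F_q(z₂) equal to this; univalence of F_p gives ζ₀ = w(z₂), against
Schwarz. -/
theorem image_subset_of_superordination {p q u v w : ℂ → ℂ}
    (hu : IsDiskLog u p) (hv : IsDiskLog v q) (hpu : IsUnivalent p)
    (hFu : InjOn (powerExpr α β γ δ μ u p) unitDisk)
    (hq : ClassR α β γ δ μ q) (hqu : IsUnivalent q) (hpos : PositivityConditions α β γ δ μ q)
    (hw : AnalyticOnNhd ℂ w unitDisk) (hw0 : w 0 = 0) (hw1 : ∀ z ∈ unitDisk, ‖w z‖ < 1)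
    (heq : ∀ z ∈ unitDisk, powerExpr α β γ δ μ v q z = powerExpr α β γ δ μ u p (w z)) :
    ∀ z ∈ unitDisk, q z ∈ p '' unitDisk := by
  obtain ⟨g, T, hg, hg', hc, hT, hTg, hsym⟩ := hq.exists_convex_chain hqu hpos hv
  intro zs hzs
  obtain ⟨ρ, hzρ, hρ⟩ := exists_between (mem_unitDisk.1 hzs)
  suffices h : v zs ∈ u '' Metric.ball 0 ρ by
    obtain ⟨x, hx, hxz⟩ := h
    have hxD : x ∈ unitDisk := mem_unitDisk.2 ((mem_ball_zero_iff.1 hx).trans hρ)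
    exact ⟨x, hxD, by rw [← hu.exp_eq x hxD, hxz, hv.exp_eq zs hzs]⟩
  by_contra hnot
  obtain ⟨z₀, ζ₀, m, hz₀, hζ₀, hm, hval, hder⟩ := exists_boundary_contact hv.analytic hu.analytic
    (hu.injOn hpu.2) (by rw [hu.map_zero, hv.map_zero]) hρ hzρ hnot
  have hm0 : (0 : ℝ) < m := zero_lt_one.trans_le hm
  have hz₀D : z₀ ∈ unitDisk := mem_unitDisk.2 (hz₀.trans hρ)
  have hζD : ζ₀ ∈ unitDisk := mem_unitDisk.2 (hζ₀.trans_lt hρ)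
  obtain ⟨z₂, hz₂, hz₂eq⟩ := exists_apply_eq_of_chain hg hg' hc hT hTg (inv_nonneg.2 hm0.le)
    (inv_le_one_of_one_le₀ hm) hρ hz₀
  have hz₂D : z₂ ∈ unitDisk := mem_unitDisk.2 (hz₂.trans hρ)
  have hder' : ζ₀ * deriv u ζ₀ = (m⁻¹ : ℝ) * (z₀ * deriv v z₀) := by
    have : (m : ℂ) ≠ 0 := by exact_mod_cast hm0.ne'
    rw [hder]; push_cast; field_simp
  have h1 : powerExpr α β γ δ μ u p ζ₀ = powerExpr α β γ δ μ u p (w z₂) := by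
    rw [← heq z₂ hz₂D, hu.powerExpr_eq hζD, hv.powerExpr_eq hz₂D, ← hval, hder', hsym z₀ hz₀D,
      ← one_mul (z₂ * deriv v z₂), hsym _ hz₂D, ← hz₂eq, one_mul]
  have h2 := hFu hζD (mem_unitDisk.2 (hw1 _ hz₂D)) h1
  have h3 := norm_le_norm_of_schwarz hw hw0 hw1 hz₂D
  rw [← h2, hζ₀] at h3
  exact h3.not_gt hz₂

/-- F_q is the member s = 1 of the chain, and the close-to-convex lemma with t = 0 is injectivity.
This is what admits q₁ as a solution of its own superordination. -/
theorem injOn_powerExpr {q v : ℂ → ℂ} (hv : IsDiskLog v q)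
    (hq : ClassR α β γ δ μ q) (hqu : IsUnivalent q) (hpos : PositivityConditions α β γ δ μ q) :
    InjOn (powerExpr α β γ δ μ v q) unitDisk := by
  obtain ⟨g, T, hg, hg', hc, hT, hTg, hsym⟩ := hq.exists_convex_chain hqu hpos hv
  have key : ∀ x ∈ unitDisk, ∀ y : ℂ, ‖y‖ ≤ ‖x‖ →
      powerExpr α β γ δ μ v q y = powerExpr α β γ δ μ v q x → y = x := by
    intro x hx y hyx hxy
    have hy : y ∈ unitDisk := mem_unitDisk.2 (hyx.trans_lt (mem_unitDisk.1 hx))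
    rw [hv.powerExpr_eq hx, hv.powerExpr_eq hy, ← one_mul (x * deriv v x), hsym x hx,
      ← one_mul (y * deriv v y), hsym y hy] at hxy
    exact eq_of_apply_eq_add_normal hg hg' hc (analyticOnNhd_add_mul_normal hg hT 1)
      (fun z hz => re_deriv_div_pos hg hg' hc hT hTg zero_le_one hz) hx hyx le_rfl
      (by push_cast; linear_combination hxy)
  intro x hx y hy hxy
  rcases le_total ‖y‖ ‖x‖ with h | h
  · exact (key x hx y h hxy.symm).symm
  · exact key y hy x h hxy

/-! ### The sandwich theorem and best bounds -/

theorem subordinate_of_subordinate_diffExpr (hμ : 0 < μ) (hμ1 : μ ≤ 1) {p q : ℂ → ℂ}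
    (hp : ClassR α β γ δ μ p) (hq : ClassR α β γ δ μ q) (hqu : IsUnivalent q)
    (hpos : PositivityConditions α β γ δ μ q)
    (h : Subordinate (diffExpr α β γ δ μ p) (diffExpr α β γ δ μ q)) : Subordinate p q := by
  obtain ⟨-, -, w, hw, hw0, hw1, heq⟩ := h
  obtain ⟨u, hu⟩ := hp.exists_isDiskLog
  obtain ⟨v, hv⟩ := hq.exists_isDiskLog
  exact subordinate_of_image_subset hp.analytic hqu (by rw [hp.map_zero, hq.map_zero])
    (image_subset_of_subordination hu hv hq hqu hpos hw hw0 hw1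
      (powerExpr_eq_comp hμ hμ1 hp hu hq hv hw hw0 hw1 heq))

theorem subordinate_of_superordinate_diffExpr (hμ : 0 < μ) (hμ1 : μ ≤ 1) {p q : ℂ → ℂ}
    (hp : ClassR α β γ δ μ p) (hpu : IsUnivalent p) (hF : PowerExprUnivalent α β γ δ μ p)
    (hq : ClassR α β γ δ μ q) (hqu : IsUnivalent q) (hpos : PositivityConditions α β γ δ μ q)
    (h : Subordinate (diffExpr α β γ δ μ q) (diffExpr α β γ δ μ p)) : Subordinate q p := by
  obtain ⟨-, -, w, hw, hw0, hw1, heq⟩ := h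
  obtain ⟨u, hu1, hu2, hu3, hFu⟩ := hF
  have hu : IsDiskLog u p := ⟨hu1, hu2, hu3⟩
  obtain ⟨v, hv⟩ := hq.exists_isDiskLog
  exact subordinate_of_image_subset hq.analytic hpu (by rw [hp.map_zero, hq.map_zero])
    (image_subset_of_superordination hu hv hpu hFu.2 hq hqu hpos hw hw0 hw1
      (powerExpr_eq_comp hμ hμ1 hq hv hp hu hw hw0 hw1 heq))

theorem Subordinate.refl {f : ℂ → ℂ} (hf : AnalyticOnNhd ℂ f unitDisk) : Subordinate f f :=
  ⟨hf, hf, id, analyticOnNhd_id, rfl, fun _ hz => mem_unitDisk.1 hz, fun _ _ => rfl⟩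

/-- Contact is made on circles of radius below 1, so `ClassQ` enters the argument through interior
injectivity. -/
theorem ClassQ.injOn {f : ℂ → ℂ} (hf : ClassQ f) : InjOn f unitDisk := by
  obtain ⟨g, hgf, -, hinj, -⟩ := hf
  refine (hinj.mono fun z hz => ?_).congr hgf
  have hz' := mem_unitDisk.1 hz
  exact ⟨mem_closedBall_zero_iff.2 hz'.le, fun h => hz'.ne h.1⟩

end

theorem theorem3 (α μ : ℝ) (β γ δ : ℂ) (hμ : 0 < μ) (hμ1 : μ ≤ 1) (hαμ : 0 ≤ α + μ)
    (hβ : β ≠ 0) (q₁ q₂ : ℂ → ℂ)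
    (hR₁ : ClassR α β γ δ μ q₁) (hR₂ : ClassR α β γ δ μ q₂)
    (hu₁ : IsUnivalent q₁) (hu₂ : IsUnivalent q₂)
    (hpos₁ : PositivityConditions α β γ δ μ q₁) (hpos₂ : PositivityConditions α β γ δ μ q₂) :
    (∀ p : ℂ → ℂ, ClassR α β γ δ μ p → ClassQ p → PowerExprUnivalent α β γ δ μ p →
      Subordinate (diffExpr α β γ δ μ q₁) (diffExpr α β γ δ μ p) →
      Subordinate (diffExpr α β γ δ μ p) (diffExpr α β γ δ μ q₂) →
      Subordinate q₁ p ∧ Subordinate p q₂) ∧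
    IsBestSubordinant (superSolutions α β γ δ μ (diffExpr α β γ δ μ q₁)) q₁ ∧
    IsBestDominant (subSolutions α β γ δ μ (diffExpr α β γ δ μ q₂)) q₂ := by
  refine ⟨?_, ⟨hu₁, ⟨hR₁.analytic, ?_⟩, ?_⟩, ⟨hu₂, ?_⟩, ?_⟩
  · intro p hp hpQ hF h1 h2
    exact ⟨subordinate_of_superordinate_diffExpr hμ hμ1 hp ⟨hp.analytic, hpQ.injOn⟩ hF
        hR₁ hu₁ hpos₁ h1,
      subordinate_of_subordinate_diffExpr hμ hμ1 hp hR₂ hu₂ hpos₂ h2⟩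
  · rintro p ⟨hp, hpu, hF, h⟩
    exact subordinate_of_superordinate_diffExpr hμ hμ1 hp hpu hF hR₁ hu₁ hpos₁ h
  · intro q' hq'
    obtain ⟨v, hv⟩ := hR₁.exists_isDiskLog
    -- Every subordinant is tested on the solution q₁ itself.
    exact hq'.2 q₁ ⟨hR₁, hu₁, ⟨v, hv.analytic, hv.map_zero, hv.exp_eq,
      hR₁.analyticOnNhd_powerExpr hv, injOn_powerExpr hv hR₁ hu₁ hpos₁⟩,
      Subordinate.refl hR₁.expr_analytic⟩
  · rintro p ⟨hp, h⟩
    exact subordinate_of_subordinate_diffExpr hμ hμ1 hp hR₂ hu₂ hpos₂ h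
  · intro q' hq'
    exact hq'.2 q₂ ⟨hR₂, Subordinate.refl hR₂.expr_analytic⟩
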